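/- **Setting.** A network $Q$ carries its shortest-path metric $d$ and its length measure $\lambda$; write $\mu=\lambda(Q)$. In the continuous patrolling game $(Q,\alpha)$ the Patroller chooses a $1$-Lipschitz path $S:[0,\infty)\to Q$ (a patrol) and the Attacker chooses a point $x\in Q$ and a starting time $\tau\ge 0$. The attack is intercepted if $S(t)=x$ for some $t\in[\tau,\tau+\alpha]$. Both players may randomize; the payoff to the (maximizing) Patroller is the probability of interception. The game has value $V$ if its max-min and its min-max over mixed strategies are both equal to $V$. For a tree $Q$, the extremity set $E=E(Q,\alpha)$ is the set of points $x$ that have a neighborhood homeomorphic to an open interval and for which some connected component of $Q\setminus\{x\}$ has length less than $\alpha/2$. Put $v^*=\alpha/(\mu+\lambda(E))$ and $E^c=Q\setminus E$. **Proposition.** Let $Q$ be the star with three arcs, of lengths $6,1,1$. Let $9$ be the leaf node of the long arc and $1,2$ the leaf nodes of the two short arcs. This is a tree with $\mu=8$ and diameter $7$. Let $4\le\alpha\le 8$. Then $\lambda(E)=\alpha$, and the game has value $$V=v^*=\frac{\alpha}{\mu+\lambda(E)}=\frac{\alpha}{8+\alpha}.$$ Let $\theta=2(\mu+\lambda(E))$.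 The following mixed attack strategy (the 6-1-1-attack) is optimal: * with probability $2\alpha/\theta$, attack at node $1$ or $2$, equiprobably, with starting time uniform on $[1,1+\alpha]$; * with probability $2\lambda(E^c)/\theta$, attack at a uniformly random point of $E^c$, with starting time $\alpha/2$ or $\alpha/2+2$, equiprobably; * with probability $2\alpha/\theta$, attack at node $9$, with starting time that is uniform on $[2,\alpha]$ with conditional probability $(\alpha-2)/\alpha$, uniform on $[0,2]$ with conditional probability $1/\alpha$ and uniform on $[\alpha,\alpha+2]$ with conditional probability $1/\alpha$. These probabilities add up to $1$. Every patrol intercepts this attack with probability at most $v^*$, some patrol intercepts it with probability exactly $v^*$, and the supremum of the interception probability over all mixed patrols is $v^*$. Consequently, for $7\le\alpha<8$ the value of the game on this tree is not $\alpha/(2\mu)$. This disproves the conjecture that on every tree the value equals $\alpha/(2\mu)$ whenever $\alpha<2\mu$ and $\alpha$ is at least the diameter of the tree. -/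

import Mathlib

open MeasureTheory ProbabilityTheory Set Topology
open scoped NNReal ENNReal

noncomputable section

namespace Patrolling

/-! ## The continuous patrolling game on a metric space -/

section Game

variable {X : Type} [MetricSpace X]

/-- A patrol: a unit speed (that is, 1-Lipschitz) path `S t`, `t ≥ 0`. The set of patrols carries
the σ-algebra generated by the evaluations `S ↦ S t`. -/
abbrev Patrol (X : Type) [MetricSpace X] : Type := {S : ℝ≥0 → X // LipschitzWith 1 S}

/-- A pure attack: the attacked point and the starting time of the attack. -/
abbrev Attack (X : Type) : Type := X × ℝ≥0

/-- The patrol `S` intercepts the attack at `x` during `[τ, τ + α]` if `S t = x` for some time `t`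
of that interval. -/
def Intercepts (α : ℝ) (S : Patrol X) (a : Attack X) : Prop :=
  ∃ t : ℝ≥0, a.2 ≤ t ∧ (t : ℝ) ≤ (a.2 : ℝ) + α ∧ S.1 t = a.1

/-- Expected payoff (interception probability) when the patrol has law `P` and, independently, the
attack has law `A`. -/
def interceptProb [MeasurableSpace X] (α : ℝ) (P : Measure (Patrol X)) (A : Measure (Attack X)) :
    ℝ≥0∞ :=
  (P.prod A) {q | Intercepts α q.1 q.2}

/-- The game `(X, α)` between the maximizing Patroller and the minimizing Attacker, both using
mixed strategies, has value `v`: the lower (max-min) and the upper (min-max) value equal `v`. -/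
def HasValue (X : Type) [MetricSpace X] [MeasurableSpace X] (α : ℝ) (v : ℝ≥0∞) : Prop :=
  (⨆ P : ProbabilityMeasure (Patrol X), ⨅ A : ProbabilityMeasure (Attack X),
      interceptProb α (P : Measure (Patrol X)) (A : Measure (Attack X))) = v ∧
  (⨅ A : ProbabilityMeasure (Attack X), ⨆ P : ProbabilityMeasure (Patrol X),
      interceptProb α (P : Measure (Patrol X)) (A : Measure (Attack X))) = v

end Game

/-! ## Length, tree networks, the extremity set -/

/-- Length `λ` on a network: one-dimensional Hausdorff measure, which is Lebesgue measure on every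
arc. -/
def length (X : Type) [MetricSpace X] [MeasurableSpace X] [BorelSpace X] : Measure X :=
  Measure.hausdorffMeasure 1

/-- The total length `μ = λ(Q)`. -/
def totalLength (X : Type) [MetricSpace X] [MeasurableSpace X] [BorelSpace X] : ℝ≥0∞ :=
  length X univ

/-- A tree network, as a metric space: distances are realized by shortest paths, the space is the
union of the shortest paths between finitely many of its points, and it contains no circuit. -/
structure IsTreeNetwork (X : Type) [MetricSpace X] : Prop where
  nonempty : Nonempty X
  geodesic : ∀ x y : X, ∃ γ : ℝ → X, γ 0 = x ∧ γ (dist x y) = y ∧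
    ∀ s ∈ Icc 0 (dist x y), ∀ t ∈ Icc 0 (dist x y), dist (γ s) (γ t) = |s - t|
  finite : ∃ F : Set X, F.Finite ∧ ∀ x, ∃ a ∈ F, ∃ b ∈ F, dist a x + dist x b = dist a b
  no_circuit : ∀ γ : Circle → X, Continuous γ → ¬ Function.Injective γ

/-- A regular point: it has a neighborhood homeomorphic to an open interval. -/
def IsRegularPoint {X : Type} [MetricSpace X] (x : X) : Prop :=
  ∃ U : Set X, IsOpen U ∧ x ∈ U ∧ Nonempty (U ≃ₜ Ioo (0 : ℝ) 1)

/-- The extremity set `E(X, α)` of a tree: the regular points `x` such that some connected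
component of the complement of `x` has length less than `α / 2`. -/
def extremitySet (X : Type) [MetricSpace X] [MeasurableSpace X] [BorelSpace X] (α : ℝ) : Set X :=
  {x | IsRegularPoint x ∧
    ∃ y, y ≠ x ∧ length X (connectedComponentIn {x}ᶜ y) < ENNReal.ofReal (α / 2)}

/-- `v* = α / (μ + λ(E))`. -/
def vStar (X : Type) [MetricSpace X] [MeasurableSpace X] [BorelSpace X] (α : ℝ) : ℝ≥0∞ :=
  ENNReal.ofReal α / (totalLength X + length X (extremitySet X α))

/-- The conjecture that on every tree network the value is `α / (2 μ)` for every attack duration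
`α < 2 μ` that is at least the diameter. -/
def DiameterConjecture : Prop :=
  ∀ (X : Type) [MetricSpace X] [MeasurableSpace X] [BorelSpace X], IsTreeNetwork X →
    ∀ α : ℝ, 0 < α → Metric.diam (univ : Set X) ≤ α → ENNReal.ofReal α < 2 * totalLength X →
      HasValue X α (ENNReal.ofReal α / (2 * totalLength X))

/-! ## Stars -/

/-- The star with arcs of lengths `ℓ i`. The point of arc `i` at distance `t` from the center is
the vector with `i`-th coordinate `t` and all other coordinates `0`; the center is `0`. The
`ℓ¹`-distance of two such vectors is the length of the path in the star that joins them. -/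
abbrev Star {k : ℕ} (ℓ : Fin k → ℝ≥0) : Type :=
  {p : PiLp 1 (fun _ : Fin k => ℝ) //
    (∀ i, 0 ≤ p i ∧ p i ≤ ℓ i) ∧ ∀ i j, i ≠ j → p i = 0 ∨ p j = 0}

/-- The leaf node of arc `i`. -/
def leafNode {k : ℕ} (ℓ : Fin k → ℝ≥0) (i : Fin k) : Star ℓ :=
  ⟨WithLp.toLp 1 (Pi.single i (ℓ i : ℝ)), by
    refine ⟨fun j => ?_, fun j m hjm => ?_⟩
    · by_cases h : j = i
      · subst h; simp
      · simp [h]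
    · by_cases h : j = i
      · right; subst h; simp [Ne.symm hjm]
      · left; simp [h]⟩

/-- The star with arc lengths 6, 1, 1. -/
abbrev Star611 : Type := Star ![6, 1, 1]

/-- The leaf node at the end of the arc of length 6. -/
def node9 : Star611 := leafNode _ 0

/-- The leaf node at the end of the first arc of length 1. -/
def node1 : Star611 := leafNode _ 1

/-- The leaf node at the end of the second arc of length 1. -/
def node2 : Star611 := leafNode _ 2

/-! ## The 6-1-1-attack -/

/-- The uniform distribution on the time interval `[a, b]`, `0 ≤ a < b`. -/
def uniformTime (a b : ℝ) : Measure ℝ≥0 :=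
  (ProbabilityTheory.cond (volume : Measure ℝ) (Icc a b)).map Real.toNNReal

/-- `θ = 2 (μ + λ(E))` for the 6-1-1 star. -/
def theta (α : ℝ) : ℝ≥0∞ :=
  2 * (totalLength Star611 + length Star611 (extremitySet Star611 α))

/-- Law of the left attacks: at nodes 1 and 2 equiprobably, start time uniform in `[1, 1 + α]`. -/
def leftAttack (α : ℝ) : Measure (Attack Star611) :=
  ((1 / 2 : ℝ≥0∞) • Measure.dirac node1 + (1 / 2 : ℝ≥0∞) • Measure.dirac node2).prod
    (uniformTime 1 (1 + α))

/-- Law of the middle attacks: at a uniformly random point of the complement of `E`, start time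
`α / 2` or `α / 2 + 2` equiprobably. (If the complement of `E` has length `0` then this is the zero
measure, and it is used with weight `0`.) -/
def middleAttack (α : ℝ) : Measure (Attack Star611) :=
  (ProbabilityTheory.cond (length Star611) (extremitySet Star611 α)ᶜ).prod
    ((1 / 2 : ℝ≥0∞) • Measure.dirac (α / 2).toNNReal +
      (1 / 2 : ℝ≥0∞) • Measure.dirac (α / 2 + 2).toNNReal)

/-- Law of the start time of the right attacks: uniform on `[2, α]` with probability
`(α - 2) / α`, and uniform on each of `[0, 2]` and `[α, α + 2]` with probability `1 / α`. -/
def rightStart (α : ℝ) : Measure ℝ≥0 :=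
  ENNReal.ofReal (1 / α) • uniformTime 0 2 + ENNReal.ofReal ((α - 2) / α) • uniformTime 2 α +
    ENNReal.ofReal (1 / α) • uniformTime α (α + 2)

/-- Law of the right attacks: at node 9. -/
def rightAttack (α : ℝ) : Measure (Attack Star611) :=
  (Measure.dirac node9).prod (rightStart α)

/-- The 6-1-1-attack strategy. -/
def attack611 (α : ℝ) : Measure (Attack Star611) :=
  (2 * ENNReal.ofReal α / theta α) • leftAttack α +
    (2 * length Star611 (extremitySet Star611 α)ᶜ / theta α) • middleAttack α +
    (2 * ENNReal.ofReal α / theta α) • rightAttack α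

end Patrolling

end

/-! The value follows from a saddle point: the 6-1-1-attack holds every patrol to at most `α / (8 +
α)`, and one mixed patrol secures this against every attack (`hasValue_of_saddle`).

Attack side. The right attack is the even mixture of uniform starts on `[0, α]` and on `[2, α + 2]`.
Write `r = α / 2` and move time `α + 1` to `0`. After multiplication by `2 * (8 + α)`, the
interception probability of a patrol becomes a sum of six lengths: `I₁`, `I₂` (intercepted starts in
`[-2r, 0]` at the two near leaves), `Jm`, `Jp` (intercepted starts at the far leaf, in the intervals
of length `2r` ending at `-1` and `1`), and `Mm`, `Mp` (the part of the middle segment visited in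
the windows of radius `r` around `-1` and `1`). The claim is that the sum is at most `4 * r = 2 * α`
(`PathData.total_le`). Only the visits to leaves closest to the reference times matter. Each `I` or
`J` is at most `4r` minus the times since the last and until the next visit, and each `M` is limited
because a deep excursion into the middle needs time away from the leaves (`MiddleBound`). The
distances `2` (near to near) and `7` (near to far) give linear constraints. If the far leaf is
visited in `[-1, 1]`, past and future contribute at most `2r` each (`near_gain_le_of_far_visit`).
Otherwise a finite case analysis over which visits occur reduces the claim to linear arithmetic
(`visit_inequality_outer`).

Patrol side. With probability `8 / (8 + α)` the patrol is the full tour of period `16` with random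
phase; with probability `α / (2 * (8 + α))` each, it is a closed walk of period `α` through the part
of `E` around the center, or through the part at the far leaf. The full tour catches an attack with
probability at least `α / 16`, and at least `α / 8` in the middle, where its two visits per period
are more than `α` apart. On `E` a short walk makes up the difference (`exists_optimal_patrol`).

The value differs from `α / 16` unless `α = 8`, and the diameter is `7`; so `α = 7` refutes the
conjecture. -/

noncomputable section

namespace Patrolling

/-! ## The linear inequality between visiting times -/

/-- Constraints between a length `M` of the middle part covered during a time window of length
`2 * r` centered one time unit before a reference time, and the visiting times of the leaf nodes:
`u₁, u₂` and `w₁, w₂` are the times since the last and until the next visits to the two near leaf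
nodes, `p` and `n` those for the far leaf node. A value `2 * r` means that there is no visit. The
numbers `a` and `b` measure how deep the middle part is entered from the two sides. -/
def MiddleBound (r M p n u₁ u₂ w₁ w₂ : ℝ) : Prop :=
  M ≤ 0 ∨ ∃ a b : ℝ, M ≤ a + b - (8 - 2 * r) ∧ 0 ≤ a ∧ a ≤ 8 - 2 * r ∧ 0 ≤ b ∧ b ≤ 8 - 2 * r ∧
    (p < 2 * r → b ≤ p) ∧ (n < 2 * r → b ≤ n + 2) ∧
    (p < 2 * r → n < 2 * r → 2 * r + 2 * b ≤ p + n + 2) ∧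
    (((u₁ < 2 * r → a ≤ u₁) ∧ (u₂ < 2 * r → a ≤ u₂) ∧
        (w₁ < 2 * r → a ≤ w₁ + 2) ∧ (w₂ < 2 * r → a ≤ w₂ + 2) ∧
        (u₁ < 2 * r → w₁ < 2 * r → 2 * r - 2 + 2 * a ≤ u₁ + w₁) ∧
        (u₁ < 2 * r → w₂ < 2 * r → 2 * r - 2 + 2 * a ≤ u₁ + w₂) ∧
        (u₂ < 2 * r → w₁ < 2 * r → 2 * r - 2 + 2 * a ≤ u₂ + w₁) ∧
        (u₂ < 2 * r → w₂ < 2 * r → 2 * r - 2 + 2 * a ≤ u₂ + w₂)) ∨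
      (u₁ < 2 * r ∧ u₁ ≤ 2 - a ∧ (u₂ < 2 * r → u₁ + 2 * r - 2 + 2 * a ≤ u₂)) ∨
      (u₂ < 2 * r ∧ u₂ ≤ 2 - a ∧ (u₁ < 2 * r → u₂ + 2 * r - 2 + 2 * a ≤ u₁)))

theorem MiddleBound.swap {r M p n u₁ u₂ w₁ w₂ : ℝ} (h : MiddleBound r M p n u₁ u₂ w₁ w₂) :
    MiddleBound r M p n u₂ u₁ w₂ w₁ := by
  rcases h with hM | ⟨a, b, h1, h2, h3, h4, h5, h6, h7, h8, h9⟩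
  · exact .inl hM
  · refine .inr ⟨a, b, h1, h2, h3, h4, h5, h6, h7, h8, ?_⟩
    rcases h9 with ⟨k1, k2, k3, k4, k5, k6, k7, k8⟩ | h9 | h9
    · exact .inl ⟨k2, k1, k4, k3, k8, k7, k6, k5⟩
    · exact .inr (.inr h9)
    · exact .inr (.inl h9)

/-- Since `a ≤ 8 - 2 * r`, the near-side depth can be dropped and `M ≤ b` remains. The alternative
`b = 0` covers the case `M ≤ 0`, in which no depth is given. -/
theorem MiddleBound.le_far {r M p n u₁ u₂ w₁ w₂ : ℝ} (hr : r ≤ 4) (hp : 0 ≤ p) (hn : 0 ≤ n)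
    (h : MiddleBound r M p n u₁ u₂ w₁ w₂) :
    ∃ b, M ≤ b ∧ 0 ≤ b ∧ b ≤ 8 - 2 * r ∧ (p < 2 * r → b ≤ p) ∧ (n < 2 * r → b ≤ n + 2) ∧
      (p < 2 * r → n < 2 * r → b = 0 ∨ 2 * r + 2 * b ≤ p + n + 2) := by
  rcases h with hM | ⟨a, b, h1, h2, h3, h4, h5, h6, h7, h8, -⟩
  · exact ⟨0, hM, le_rfl, by linarith, fun _ => hp, fun _ => by linarith, fun _ _ => .inl rfl⟩
  · exact ⟨b, by linarith, h4, h5, h6, h7, fun h h' => .inr (h8 h h')⟩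

section

set_option linter.unusedSimpArgs false

variable {r u₁ u₂ w₁ w₂ p n wm up I₁ I₂ Jm Jp Mm Mp : ℝ}

-- Far visits occur on both sides. A near visit in the past has `u + 6 ≤ p < 2 * r ≤ 8`, so `u < 2`,
-- and the two-unit separation leaves at most one such node; the same holds in the future. The
-- bounds `M ≤ b` from the far side are then enough.
set_option maxHeartbeats 1000000 in
theorem visit_inequality_far_both (hr : 2 ≤ r) (hr4 : r ≤ 4)
    (u1n : 0 ≤ u₁) (u2n : 0 ≤ u₂) (w1n : 0 ≤ w₁) (w2n : 0 ≤ w₂) (pn : 0 ≤ p) (nn : 0 ≤ n)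
    (u1r : u₁ ≤ 2 * r) (u2r : u₂ ≤ 2 * r) (w1r : w₁ ≤ 2 * r) (w2r : w₂ ≤ 2 * r)
    (hI1 : I₁ ≤ 2 * r) (hI1' : I₁ ≤ 4 * r - u₁ - w₁)
    (hI2 : I₂ ≤ 2 * r) (hI2' : I₂ ≤ 4 * r - u₂ - w₂)
    (hJm : Jm ≤ 4 * r - p - wm) (hJp : Jp ≤ 4 * r - n - up)
    (hJm' : Jm ≤ 2 * r) (hJp' : Jp ≤ 2 * r)
    (hwm : 2 * r ≤ wm ∨ n + 2 ≤ wm) (hup : 2 * r ≤ up ∨ p + 2 ≤ up)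
    (huu : u₂ = 2 * r ∨ u₁ + 2 ≤ u₂)
    (hww : (w₁ ≤ w₂ ∧ (w₂ = 2 * r ∨ w₁ + 2 ≤ w₂)) ∨ (w₂ ≤ w₁ ∧ (w₁ = 2 * r ∨ w₂ + 2 ≤ w₁)))
    (h12 : 2 ≤ u₁ + w₂) (h21 : 2 ≤ u₂ + w₁)
    (hp : p < 2 * r) (hn : n < 2 * r)
    (hp1 : u₁ < 2 * r → u₁ + 6 ≤ p) (hp2 : u₂ < 2 * r → u₂ + 6 ≤ p)
    (hp3 : w₁ < 2 * r → 6 ≤ p + w₁) (hp4 : w₂ < 2 * r → 6 ≤ p + w₂)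
    (hn1 : w₁ < 2 * r → w₁ + 6 ≤ n) (hn2 : w₂ < 2 * r → w₂ + 6 ≤ n)
    (hn3 : u₁ < 2 * r → 6 ≤ n + u₁) (hn4 : u₂ < 2 * r → 6 ≤ n + u₂)
    (hMm : MiddleBound r Mm p n u₁ u₂ w₁ w₂) (hMp : MiddleBound r Mp n p w₁ w₂ u₁ u₂) :
    I₁ + I₂ + Jm + Jp + Mm + Mp ≤ 4 * r := by
  obtain ⟨b, _, _, _, hb1, hb2, hb⟩ := hMm.le_far hr4 pn nn
  obtain ⟨d, _, _, _, hd1, hd2, hd⟩ := hMp.le_far hr4 nn pn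
  replace hb1 := hb1 hp
  replace hb2 := hb2 hn
  replace hb := hb hp hn
  replace hd1 := hd1 hn
  replace hd2 := hd2 hp
  replace hd := hd hn hp
  clear hMm hMp
  -- Each of the four near values either records a visit (`< 2 * r`) or is the default `2 * r`. Once
  -- this is fixed, the conditional constraints become linear or disappear.
  rcases u1r.lt_or_eq with h | rfl <;> rcases u2r.lt_or_eq with h' | rfl <;>
  rcases w1r.lt_or_eq with h3 | rfl <;> rcases w2r.lt_or_eq with h4 | rfl <;>
  simp only [*, ne_of_lt, lt_irrefl, true_imp_iff, false_imp_iff, false_or, true_or, true_and,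
    and_true] at hww huu hp1 hp2 hp3 hp4 hn1 hn2 hn3 hn4 <;>
  first
  | linarith
  | (rcases hwm with hwm | hwm <;> rcases hup with hup | hup <;>
      first
      | linarith
      | (casesm* _ ∧ _, _ ∨ _ <;> linarith))

-- A far visit occurs only in the past. Future near visits are then not confined by a next far
-- visit, so the later middle window needs its full near-side alternatives, while `Mm ≤ p` suffices
-- for the earlier one. In `hMp` time is reversed, which exchanges the `u` with the `w` and `p` with
-- `n`.
set_option maxHeartbeats 1000000 in
theorem visit_inequality_far_before (hr : 2 ≤ r) (hr4 : r ≤ 4)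
    (u1n : 0 ≤ u₁) (u2n : 0 ≤ u₂) (w1n : 0 ≤ w₁) (w2n : 0 ≤ w₂) (pn : 0 ≤ p)
    (u1r : u₁ ≤ 2 * r) (u2r : u₂ ≤ 2 * r) (w1r : w₁ ≤ 2 * r) (w2r : w₂ ≤ 2 * r)
    (hI1 : I₁ ≤ 2 * r) (hI1' : I₁ ≤ 4 * r - u₁ - w₁)
    (hI2' : I₂ ≤ 4 * r - u₂ - w₂)
    (hJm : Jm ≤ 2 * r - p) (hJp : Jp ≤ 2 * r - up)
    (hup : 2 * r ≤ up ∨ p + 2 ≤ up)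
    (huu : u₂ = 2 * r ∨ u₁ + 2 ≤ u₂)
    (hww : (w₁ ≤ w₂ ∧ (w₂ = 2 * r ∨ w₁ + 2 ≤ w₂)) ∨ (w₂ ≤ w₁ ∧ (w₁ = 2 * r ∨ w₂ + 2 ≤ w₁)))
    (h12 : 2 ≤ u₁ + w₂) (h21 : 2 ≤ u₂ + w₁) (hp : p < 2 * r)
    (hp1 : u₁ < 2 * r → u₁ + 6 ≤ p) (hp2 : u₂ < 2 * r → u₂ + 6 ≤ p)
    (hp3 : w₁ < 2 * r → 6 ≤ p + w₁) (hp4 : w₂ < 2 * r → 6 ≤ p + w₂)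
    (hMm : Mm ≤ p) (hMm' : Mm ≤ 8 - 2 * r) (hMp : MiddleBound r Mp (2 * r) p w₁ w₂ u₁ u₂) :
    I₁ + I₂ + Jm + Jp + Mm + Mp ≤ 4 * r := by
  rcases hMp with hMp | ⟨a, b, h1, h2, h3, h4, h5, -, h7, -, h9⟩
  all_goals
    try replace h7 := h7 hp
    rcases u1r.lt_or_eq with h | rfl <;> rcases u2r.lt_or_eq with h' | rfl <;>
    rcases w1r.lt_or_eq with h3 | rfl <;> rcases w2r.lt_or_eq with h4 | rfl <;>
    (try simp only [*, ne_of_lt, lt_irrefl, true_imp_iff, false_imp_iff, false_or, true_or,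
      true_and, false_and, and_true, or_false] at h9) <;>
    simp only [*, ne_of_lt, lt_irrefl, true_imp_iff, false_imp_iff, false_or, true_or, true_and,
      and_true] at hww huu hp1 hp2 hp3 hp4 <;>
    first
    | linarith
    | (casesm* _ ∧ _, _ ∨ _ <;> linarith)

-- Without far visits the `J` terms vanish, and the near leaves compete only with the middle
-- segment; both windows need their near-side constraints.
set_option maxHeartbeats 1000000 in
theorem visit_inequality_far_never (hr : 2 ≤ r)
    (u1n : 0 ≤ u₁) (u2n : 0 ≤ u₂) (w1n : 0 ≤ w₁) (w2n : 0 ≤ w₂)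
    (u1r : u₁ ≤ 2 * r) (u2r : u₂ ≤ 2 * r) (w1r : w₁ ≤ 2 * r) (w2r : w₂ ≤ 2 * r)
    (hI1 : I₁ ≤ 2 * r) (hI1' : I₁ ≤ 4 * r - u₁ - w₁)
    (hI2 : I₂ ≤ 2 * r) (hI2' : I₂ ≤ 4 * r - u₂ - w₂)
    (huu : u₂ = 2 * r ∨ u₁ + 2 ≤ u₂)
    (hww : (w₁ ≤ w₂ ∧ (w₂ = 2 * r ∨ w₁ + 2 ≤ w₂)) ∨ (w₂ ≤ w₁ ∧ (w₁ = 2 * r ∨ w₂ + 2 ≤ w₁)))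
    (h12 : 2 ≤ u₁ + w₂) (h21 : 2 ≤ u₂ + w₁)
    (hMm : MiddleBound r Mm (2 * r) (2 * r) u₁ u₂ w₁ w₂)
    (hMp : MiddleBound r Mp (2 * r) (2 * r) w₁ w₂ u₁ u₂) :
    I₁ + I₂ + Mm + Mp ≤ 4 * r := by
  rcases hMm with hMm | ⟨a, b, g1, g2, g3, g4, g5, -, -, -, g9⟩ <;>
  rcases hMp with hMp | ⟨c, d, k1, k2, k3, k4, k5, -, -, -, k9⟩
  all_goals
    rcases u1r.lt_or_eq with h | rfl <;> rcases u2r.lt_or_eq with h' | rfl <;>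
    rcases w1r.lt_or_eq with h3 | rfl <;> rcases w2r.lt_or_eq with h4 | rfl <;>
    (try simp only [*, ne_of_lt, lt_irrefl, true_imp_iff, false_imp_iff, false_or, true_or,
      true_and, false_and, and_true, or_false] at g9) <;>
    (try simp only [*, ne_of_lt, lt_irrefl, true_imp_iff, false_imp_iff, false_or, true_or,
      true_and, false_and, and_true, or_false] at k9) <;>
    simp only [*, ne_of_lt, lt_irrefl, true_imp_iff, false_imp_iff, false_or, true_or, true_and,
      and_true] at hww huu <;>
    first
    | linarith
    | (casesm* _ ∧ _, _ ∨ _ <;> linarith)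

end

/-! ### Assembling the linear inequality from the cases of far visits -/

section

variable {r u₁ u₂ w₁ w₂ p n wm up I₁ I₂ Jm Jp Mm Mp : ℝ}

theorem eq_or_add_two_le_of_separated (h₁₂ : u₁ ≤ u₂) (h₂ : u₂ ≤ 2 * r)
    (h : u₁ < 2 * r → u₂ < 2 * r → 2 ≤ |u₁ - u₂|) : u₂ = 2 * r ∨ u₁ + 2 ≤ u₂ := by
  rcases h₂.lt_or_eq with h' | h'
  · have := h (by linarith) h'
    rw [abs_of_nonpos (by linarith)] at this
    exact .inr (by linarith)
  · exact .inl h'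

theorem ordered_of_separated (h₁ : u₁ ≤ 2 * r) (h₂ : u₂ ≤ 2 * r)
    (h : u₁ < 2 * r → u₂ < 2 * r → 2 ≤ |u₁ - u₂|) :
    (u₁ ≤ u₂ ∧ (u₂ = 2 * r ∨ u₁ + 2 ≤ u₂)) ∨ (u₂ ≤ u₁ ∧ (u₁ = 2 * r ∨ u₂ + 2 ≤ u₁)) := by
  rcases le_total u₁ u₂ with h' | h'
  · exact .inl ⟨h', eq_or_add_two_le_of_separated h' h₂ h⟩
  · exact .inr ⟨h', eq_or_add_two_le_of_separated h' h₁ fun a b => by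
      rw [abs_sub_comm]; exact h b a⟩

/-- The main inequality when the far leaf node is not visited within one time unit of the
reference time. -/
theorem visit_inequality_outer (hr : 2 ≤ r) (hr4 : r ≤ 4)
    (u1n : 0 ≤ u₁) (u2n : 0 ≤ u₂) (w1n : 0 ≤ w₁) (w2n : 0 ≤ w₂) (pn : 0 ≤ p) (nn : 0 ≤ n)
    (u1r : u₁ ≤ 2 * r) (u2r : u₂ ≤ 2 * r) (w1r : w₁ ≤ 2 * r) (w2r : w₂ ≤ 2 * r)
    (pr : p ≤ 2 * r) (nr : n ≤ 2 * r)
    (hI1 : I₁ ≤ 2 * r) (hI1' : I₁ ≤ 4 * r - u₁ - w₁)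
    (hI2 : I₂ ≤ 2 * r) (hI2' : I₂ ≤ 4 * r - u₂ - w₂)
    (hJm : Jm ≤ 4 * r - p - wm) (hJp : Jp ≤ 4 * r - n - up)
    (hJm' : Jm ≤ 2 * r) (hJp' : Jp ≤ 2 * r)
    (hwm : 2 * r ≤ wm ∨ n + 2 ≤ wm) (hup : 2 * r ≤ up ∨ p + 2 ≤ up)
    (huu : u₁ < 2 * r → u₂ < 2 * r → 2 ≤ |u₁ - u₂|)
    (hww : w₁ < 2 * r → w₂ < 2 * r → 2 ≤ |w₁ - w₂|)
    (h12 : u₁ < 2 * r → w₂ < 2 * r → 2 ≤ u₁ + w₂)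
    (h21 : u₂ < 2 * r → w₁ < 2 * r → 2 ≤ u₂ + w₁)
    (hpu₁ : p < 2 * r → u₁ < 2 * r → u₁ + 6 ≤ p) (hpu₂ : p < 2 * r → u₂ < 2 * r → u₂ + 6 ≤ p)
    (hpw₁ : p < 2 * r → w₁ < 2 * r → 6 ≤ p + w₁) (hpw₂ : p < 2 * r → w₂ < 2 * r → 6 ≤ p + w₂)
    (hnw₁ : n < 2 * r → w₁ < 2 * r → w₁ + 6 ≤ n) (hnw₂ : n < 2 * r → w₂ < 2 * r → w₂ + 6 ≤ n)
    (hnu₁ : n < 2 * r → u₁ < 2 * r → 6 ≤ n + u₁) (hnu₂ : n < 2 * r → u₂ < 2 * r → 6 ≤ n + u₂)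
    (hMm : MiddleBound r Mm p n u₁ u₂ w₁ w₂) (hMp : MiddleBound r Mp n p w₁ w₂ u₁ u₂) :
    I₁ + I₂ + Jm + Jp + Mm + Mp ≤ 4 * r := by
  -- A missing visit has the default value `2 * r ≥ 4`, so the separation by `2` holds without
  -- assuming that the visits exist.
  have cross : ∀ x y : ℝ, 0 ≤ x → 0 ≤ y → x ≤ 2 * r → y ≤ 2 * r →
      (x < 2 * r → y < 2 * r → 2 ≤ x + y) → 2 ≤ x + y := by
    intro x y hx hy hx' hy' h
    rcases hx'.lt_or_eq with h1 | h1
    · rcases hy'.lt_or_eq with h2 | h2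
      · exact h h1 h2
      · linarith
    · linarith
  have h12' := cross _ _ u1n w2n u1r w2r h12
  have h21' := cross _ _ u2n w1n u2r w1r h21
  have huu' := ordered_of_separated u1r u2r huu
  have hww' := ordered_of_separated w1r w2r hww
  rcases pr.lt_or_eq with hp | hp <;> rcases nr.lt_or_eq with hn | hn
  · rcases huu' with ⟨-, huu'⟩ | ⟨-, huu'⟩
    · exact visit_inequality_far_both hr hr4 u1n u2n w1n w2n pn nn u1r u2r w1r w2r hI1 hI1' hI2 hI2'
        hJm hJp hJm' hJp' hwm hup huu' hww' h12' h21' hp hn (hpu₁ hp) (hpu₂ hp) (hpw₁ hp) (hpw₂ hp)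
        (hnw₁ hn) (hnw₂ hn) (hnu₁ hn) (hnu₂ hn) hMm hMp
    · rw [add_comm I₁]
      exact visit_inequality_far_both hr hr4 u2n u1n w2n w1n pn nn u2r u1r w2r w1r hI2 hI2' hI1 hI1'
        hJm hJp hJm' hJp' hwm hup huu' hww'.symm h21' h12' hp hn (hpu₂ hp) (hpu₁ hp) (hpw₂ hp)
        (hpw₁ hp) (hnw₂ hn) (hnw₁ hn) (hnu₂ hn) (hnu₁ hn) hMm.swap hMp.swap
  · have hwm' : 2 * r ≤ wm := by rcases hwm with h | h <;> linarith
    obtain ⟨b, hb, -, hb', hb'', -⟩ := hMm.le_far hr4 pn nn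
    replace hb'' := hb'' hp
    rw [hn] at hMp
    rcases huu' with ⟨-, huu'⟩ | ⟨-, huu'⟩
    · exact visit_inequality_far_before hr hr4 u1n u2n w1n w2n pn u1r u2r w1r w2r hI1 hI1' hI2'
        (by linarith) (by linarith) hup huu' hww' h12' h21' hp (hpu₁ hp) (hpu₂ hp) (hpw₁ hp)
        (hpw₂ hp) (by linarith) (by linarith) hMp
    · rw [add_comm I₁]
      exact visit_inequality_far_before hr hr4 u2n u1n w2n w1n pn u2r u1r w2r w1r hI2 hI2' hI1'
        (by linarith) (by linarith) hup huu' hww'.symm h21' h12' hp (hpu₂ hp) (hpu₁ hp) (hpw₂ hp)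
        (hpw₁ hp) (by linarith) (by linarith) hMp.swap
  -- The far visit lies only in the future. This is the previous case under time reversal.
  · have hup' : 2 * r ≤ up := by rcases hup with h | h <;> linarith
    obtain ⟨b, hb, -, hb', hb'', -⟩ := hMp.le_far hr4 nn pn
    replace hb'' := hb'' hn
    rw [hp] at hMm
    rcases hww' with ⟨-, hww'⟩ | ⟨-, hww'⟩
    · have := visit_inequality_far_before (I₂ := I₂) (Jm := Jp) (Jp := Jm) hr hr4 w1n w2n u1n u2n nn
        w1r w2r u1r u2r hI1 (by linarith) (by linarith) (by linarith) (by linarith) hwm hww' huu'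
        (by linarith) (by linarith) hn (hnw₁ hn) (hnw₂ hn) (hnu₁ hn) (hnu₂ hn)
        (hb.trans hb'') (hb.trans hb') hMm
      linarith
    · have := visit_inequality_far_before (I₂ := I₁) (Jm := Jp) (Jp := Jm) hr hr4 w2n w1n u2n u1n nn
        w2r w1r u2r u1r hI2 (by linarith) (by linarith) (by linarith) (by linarith) hwm hww' huu'.symm
        (by linarith) (by linarith) hn (hnw₂ hn) (hnw₁ hn) (hnu₂ hn) (hnu₁ hn)
        (hb.trans hb'') (hb.trans hb') hMm.swap
      linarith
  · have hwm' : 2 * r ≤ wm := by rcases hwm with h | h <;> linarith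
    have hup' : 2 * r ≤ up := by rcases hup with h | h <;> linarith
    rw [hp, hn] at hMm hMp
    rcases huu' with ⟨-, huu'⟩ | ⟨-, huu'⟩
    · have := visit_inequality_far_never hr u1n u2n w1n w2n u1r u2r w1r w2r hI1 hI1' hI2 hI2'
        huu' hww' h12' h21' hMm hMp
      linarith
    · have := visit_inequality_far_never hr u2n u1n w2n w1n u2r u1r w2r w1r hI2 hI2' hI1 hI1'
        huu' hww'.symm h21' h12' hMm.swap hMp.swap
      linarith

/-- A near visit costs more than the far visit gains, on one side of the reference time. -/
theorem near_gain_le_of_far_visit (hr4 : r ≤ 4)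
    (u1r : u₁ ≤ 2 * r) (u2r : u₂ ≤ 2 * r) (pr : p ≤ 2 * r) (hwm : wm ≤ 2)
    (hJm : Jm ≤ 4 * r - p - wm) (hJm' : Jm ≤ 2 * r)
    (huu : u₁ < 2 * r → u₂ < 2 * r → 2 ≤ |u₁ - u₂|)
    (h₁ : u₁ < 2 * r → 8 ≤ u₁ + wm) (h₂ : u₂ < 2 * r → 8 ≤ u₂ + wm)
    (hpu₁ : p < 2 * r → u₁ < 2 * r → u₁ + 6 ≤ p) (hpu₂ : p < 2 * r → u₂ < 2 * r → u₂ + 6 ≤ p)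
    (hM : Mm ≤ 0 ∨ (Mm ≤ 8 - 2 * r ∧ Mm ≤ wm ∧ (p < 2 * r → 2 * r + 2 * Mm ≤ p + wm))) :
    (2 * r - u₁) + (2 * r - u₂) + Jm + Mm ≤ 2 * r := by
  -- At most one near leaf has a visit: the more recent one has `u ≥ 8 - wm ≥ 6`, so the other would
  -- be at least `8 ≥ 2 * r` back. If there is one, then `p ≥ u + 6` rules out an earlier far visit.
  rcases ordered_of_separated u1r u2r huu with ⟨h, h'⟩ | ⟨h, h'⟩
  · have h2 : u₂ = 2 * r := by
      rcases h' with h' | h'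
      · exact h'
      · have := h₁ (by linarith)
        linarith
    rcases u1r.lt_or_eq with h1 | h1
    · have := h₁ h1
      have hp : p = 2 * r := by
        rcases pr.lt_or_eq with hp | hp
        · have := hpu₁ hp h1
          linarith
        · exact hp
      rcases hM with hM | ⟨hM, -, -⟩ <;> linarith
    · rcases hM with hM | ⟨hM, hM', hM''⟩
      · linarith
      · rcases pr.lt_or_eq with hp | hp
        · have := hM'' hp
          rcases le_total 0 Mm with h0 | h0 <;> linarith
        · linarith
  · have h2 : u₁ = 2 * r := by
      rcases h' with h' | h'
      · exact h'
      · have := h₂ (by linarith)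
        linarith
    rcases u2r.lt_or_eq with h1 | h1
    · have := h₂ h1
      have hp : p = 2 * r := by
        rcases pr.lt_or_eq with hp | hp
        · have := hpu₂ hp h1
          linarith
        · exact hp
      rcases hM with hM | ⟨hM, -, -⟩ <;> linarith
    · rcases hM with hM | ⟨hM, hM', hM''⟩
      · linarith
      · rcases pr.lt_or_eq with hp | hp
        · have := hM'' hp
          rcases le_total 0 Mm with h0 | h0 <;> linarith
        · linarith

end

/-! ## Visiting times of a path -/

/-- The waiting time is truncated at `L`, which also serves as the default when there is no visit in
`[c - L, c]`; closedness of `V` provides a latest visit otherwise. -/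
theorem exists_last_visit {V : Set ℝ} (hV : IsClosed V) (c : ℝ) {L : ℝ} (hL : 0 ≤ L) :
    ∃ u, 0 ≤ u ∧ u ≤ L ∧ (u < L → c - u ∈ V) ∧ ∀ v ∈ V, v ≤ c → v ≤ c - u := by
  by_cases hne : (V ∩ Icc (c - L) c).Nonempty
  · have hK : IsCompact (V ∩ Icc (c - L) c) := isCompact_Icc.inter_left hV
    obtain ⟨x, ⟨hxV, hx⟩, hmax⟩ := hK.exists_isGreatest hne
    refine ⟨c - x, by linarith [hx.2], by linarith [hx.1], fun _ => by simpa using hxV, ?_⟩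
    intro v hv hvc
    by_cases h : c - L ≤ v
    · have := hmax ⟨hv, h, hvc⟩
      linarith
    · linarith [hx.1]
  · refine ⟨L, hL, le_rfl, fun h => absurd h (lt_irrefl _), fun v hv hvc => ?_⟩
    by_contra h
    exact hne ⟨v, hv, by linarith, hvc⟩

theorem exists_next_visit {V : Set ℝ} (hV : IsClosed V) (c : ℝ) {L : ℝ} (hL : 0 ≤ L) :
    ∃ w, 0 ≤ w ∧ w ≤ L ∧ (w < L → c + w ∈ V) ∧ ∀ v ∈ V, c ≤ v → c + w ≤ v := by
  obtain ⟨w, h0, h1, h2, h3⟩ := exists_last_visit (V := (fun x => -x) ⁻¹' V)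
    (hV.preimage continuous_neg) (-c) hL
  refine ⟨w, h0, h1, fun h => ?_, fun v hv hvc => ?_⟩
  · have := h2 h
    simp only [mem_preimage, neg_sub, sub_neg_eq_add] at this
    rwa [add_comm]
  · have := h3 (-v) (by simpa using hv) (by linarith)
    linarith

/-- The starting times `τ ∈ [c - L, c]` of attacks of duration `L` that are intercepted at one of
the times in `V`. -/
def interceptedStarts (V : Set ℝ) (c L : ℝ) : Set ℝ :=
  {τ ∈ Icc (c - L) c | ∃ v ∈ V, τ ≤ v ∧ v ≤ τ + L}

theorem volume_interceptedStarts_ne_top (V : Set ℝ) (c L : ℝ) :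
    volume (interceptedStarts V c L) ≠ ∞ :=
  ((measure_mono (sep_subset _ _)).trans_lt measure_Icc_lt_top).ne

theorem volume_interceptedStarts_le (V : Set ℝ) (c : ℝ) {L : ℝ} (hL : 0 ≤ L) :
    (volume (interceptedStarts V c L)).toReal ≤ L := by
  refine ENNReal.toReal_le_of_le_ofReal hL ((measure_mono (sep_subset _ _)).trans ?_)
  rw [Real.volume_Icc]
  exact ENNReal.ofReal_le_ofReal (by linarith)

/-- A start is caught either by a visit up to `c`, and then it is at most `c - u`, or by a visit
from `c` on, and then it is at least `c + w - L`. These two intervals have lengths `L - u` and `L -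
w`. -/
theorem volume_interceptedStarts_le_of_gap {V : Set ℝ} {c L u w : ℝ}
    (hu : u ≤ L) (hw : w ≤ L)
    (hlast : ∀ v ∈ V, v ≤ c → v ≤ c - u) (hnext : ∀ v ∈ V, c ≤ v → c + w ≤ v) :
    (volume (interceptedStarts V c L)).toReal ≤ 2 * L - u - w := by
  refine ENNReal.toReal_le_of_le_ofReal (by linarith) ?_
  have hsub : interceptedStarts V c L ⊆ Icc (c - L) (c - u) ∪ Icc (c + w - L) c := by
    rintro τ ⟨hτ, v, hv, h1, h2⟩
    rcases le_total v c with h | h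
    · exact .inl ⟨hτ.1, h1.trans (hlast v hv h)⟩
    · exact .inr ⟨by linarith [hnext v hv h], hτ.2⟩
  refine (measure_mono hsub).trans ((measure_union_le _ _).trans ?_)
  rw [Real.volume_Icc, Real.volume_Icc, ← ENNReal.ofReal_add (by linarith) (by linarith)]
  exact ENNReal.ofReal_le_ofReal (by linarith)

/-- The part of `[r - 2, 6 - r]` that the function `y` visits in the time window of length `2 * r`
centered at `c`. -/
def visitedMiddle (y : ℝ → ℝ) (r c : ℝ) : Set ℝ :=
  {x ∈ Icc (r - 2) (6 - r) | ∃ s ∈ Icc (c - r) (c + r), y s = x}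

theorem volume_visitedMiddle_ne_top (y : ℝ → ℝ) (r c : ℝ) :
    volume (visitedMiddle y r c) ≠ ∞ :=
  ((measure_mono (sep_subset _ _)).trans_lt measure_Icc_lt_top).ne

/-- The data of a patrol of the star with arcs `6, 1, 1` that matter for the upper bound: the
coordinate `y` on the long arc, and the sets of times at which the near leaf nodes are visited. -/
structure PathData (y : ℝ → ℝ) (V₁ V₂ : Set ℝ) : Prop where
  lipschitz : ∀ s t, |y s - y t| ≤ |s - t|
  closed₁ : IsClosed V₁
  closed₂ : IsClosed V₂
  separated : ∀ v ∈ V₁, ∀ v' ∈ V₂, 2 ≤ |v - v'|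
  near : ∀ v ∈ V₁ ∪ V₂, ∀ t, y t ≤ max 0 (|t - v| - 1)

namespace PathData

variable {y : ℝ → ℝ} {V₁ V₂ : Set ℝ}

theorem continuous (h : PathData y V₁ V₂) : Continuous y :=
  (LipschitzWith.of_dist_le_mul (K := 1) fun s t => by
    simpa [Real.dist_eq] using h.lipschitz s t).continuous

theorem closed_far (h : PathData y V₁ V₂) : IsClosed {s | y s = 6} :=
  isClosed_eq h.continuous continuous_const

theorem far (h : PathData y V₁ V₂) {v s : ℝ} (hv : v ∈ V₁ ∪ V₂) (hs : y s = 6) :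
    7 ≤ |s - v| := by
  have := h.near v hv s
  rw [hs, le_max_iff] at this
  rcases this with h | h <;> linarith

/-- Let `t` and `z` be a maximum and a minimum point of `y` on the window. The visited part lies
between these two extreme values, and `a`, `b` are the depths they reach from the center side and
from the far side. Being that deep at `t` or `z` forces a time distance from every leaf visit. -/
theorem middle (h : PathData y V₁ V₂) {r : ℝ} (hr : 2 ≤ r) (c : ℝ) :
    (volume (visitedMiddle y r c)).toReal ≤ 0 ∨ ∃ a b t z : ℝ,
      (volume (visitedMiddle y r c)).toReal ≤ a + b - (8 - 2 * r) ∧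
      0 < a ∧ a ≤ 8 - 2 * r ∧ 0 < b ∧ b ≤ 8 - 2 * r ∧ |t - c| ≤ r ∧ |z - c| ≤ r ∧
      (∀ v ∈ V₁ ∪ V₂, r - 1 + a ≤ |t - v|) ∧ ∀ v, y v = 6 → r + b ≤ |z - v| := by
  have hne : (Icc (c - r) (c + r)).Nonempty := nonempty_Icc.2 (by linarith)
  obtain ⟨t, ht, hmax⟩ := isCompact_Icc.exists_isMaxOn hne h.continuous.continuousOn
  obtain ⟨z, hz, hmin⟩ := isCompact_Icc.exists_isMinOn hne h.continuous.continuousOn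
  have hsub : visitedMiddle y r c ⊆ Icc (max (y z) (r - 2)) (min (y t) (6 - r)) := by
    rintro x ⟨hx, s, hs, rfl⟩
    exact ⟨max_le (hmin hs) hx.1, le_min (hmax hs) hx.2⟩
  have hvol := measure_mono (μ := volume) hsub
  rw [Real.volume_Icc] at hvol
  by_cases hpos : min (y t) (6 - r) - max (y z) (r - 2) ≤ 0
  · left
    rw [ENNReal.ofReal_of_nonpos hpos] at hvol
    exact ENNReal.toReal_le_of_le_ofReal le_rfl (by simpa using hvol)
  · right
    push Not at hpos
    have h1 := min_le_left (y t) (6 - r)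
    have h2 := min_le_right (y t) (6 - r)
    have h3 := le_max_left (y z) (r - 2)
    have h4 := le_max_right (y z) (r - 2)
    refine ⟨min (y t) (6 - r) - (r - 2), 6 - r - max (y z) (r - 2), t, z, ?_, by linarith,
      by linarith, by linarith, by linarith, ?_, ?_, ?_, ?_⟩
    · exact ENNReal.toReal_le_of_le_ofReal (by linarith)
        (hvol.trans (ENNReal.ofReal_le_ofReal (by linarith)))
    · rw [abs_le]; constructor <;> linarith [ht.1, ht.2]
    · rw [abs_le]; constructor <;> linarith [hz.1, hz.2]
    · intro v hv
      have := h.near v hv t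
      rw [le_max_iff] at this
      rcases this with h | h <;> linarith
    · intro v hv
      have := h.lipschitz v z
      rw [hv, abs_sub_comm v z] at this
      linarith [le_abs_self (6 - y z)]

end PathData

/-! ### From distances in time to the bounds on the middle part -/

section

variable {r M a b t z p n wm u₁ u₂ w₁ w₂ : ℝ}

/-- The times `t` and `z` lie within `r` of `-1`, so most absolute values have a known sign: `z`
lies between the two far visits, and `t` before the next near visits. Only the position of `t`
relative to the last near visits is open, which yields the three alternatives of `MiddleBound`. -/
theorem middleBound_of_visits (hM : M ≤ a + b - (8 - 2 * r))
    (ha : 0 < a) (ha' : a ≤ 8 - 2 * r) (hb : 0 < b) (hb' : b ≤ 8 - 2 * r)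
    (ht : |t - -1| ≤ r) (hz : |z - -1| ≤ r)
    (u1n : 0 ≤ u₁) (u2n : 0 ≤ u₂) (w1n : 0 ≤ w₁) (w2n : 0 ≤ w₂) (pn : 0 ≤ p) (nn : 0 ≤ n)
    (huu : u₁ < 2 * r → u₂ < 2 * r → 2 ≤ |u₁ - u₂|)
    (hu₁ : u₁ < 2 * r → r - 1 + a ≤ |t - -u₁|) (hu₂ : u₂ < 2 * r → r - 1 + a ≤ |t - -u₂|)
    (hw₁ : w₁ < 2 * r → r - 1 + a ≤ |t - w₁|) (hw₂ : w₂ < 2 * r → r - 1 + a ≤ |t - w₂|)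
    (hp : p < 2 * r → r + b ≤ |z - (-1 - p)|) (hn : n < 2 * r → r + b ≤ |z - (1 + n)|) :
    MiddleBound r M p n u₁ u₂ w₁ w₂ := by
  obtain ⟨ht1, ht2⟩ := abs_le.1 ht
  obtain ⟨hz1, hz2⟩ := abs_le.1 hz
  have hp' : p < 2 * r → r + b ≤ z + 1 + p := fun h => by
    rcases le_abs.1 (hp h) with h' | h' <;> linarith
  have hn' : n < 2 * r → r + b ≤ 1 + n - z := fun h => by
    rcases le_abs.1 (hn h) with h' | h' <;> linarith
  have hw' : ∀ {w}, 0 ≤ w → r - 1 + a ≤ |t - w| → r - 1 + a ≤ w - t := fun h0 h => by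
    rcases le_abs.1 h with h' | h' <;> linarith
  have hw₁' := fun h => hw' w1n (hw₁ h)
  have hw₂' := fun h => hw' w2n (hw₂ h)
  refine .inr ⟨a, b, hM, ha.le, ha', hb.le, hb', fun h => by linarith [hp' h],
    fun h => by linarith [hn' h], fun h h' => by linarith [hp' h, hn' h'], ?_⟩
  -- Here the deepest point is reached before the last visit to the first near leaf. A last visit to
  -- the other near leaf must then precede `t`: otherwise both visits would lie within `2 - a < 2`
  -- of time `0`, against their separation.
  by_cases hneg₁ : u₁ < 2 * r ∧ r - 1 + a ≤ -(t + u₁)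
  · refine .inr (.inl ⟨hneg₁.1, by linarith, fun h => ?_⟩)
    rcases le_abs.1 (hu₂ h) with h' | h'
    · linarith
    · rcases le_abs.1 (huu hneg₁.1 h) with h'' | h'' <;> linarith
  by_cases hneg₂ : u₂ < 2 * r ∧ r - 1 + a ≤ -(t + u₂)
  · refine .inr (.inr ⟨hneg₂.1, by linarith, fun h => ?_⟩)
    rcases le_abs.1 (hu₁ h) with h' | h'
    · linarith
    · rcases le_abs.1 (huu h hneg₂.1) with h'' | h'' <;> linarith
  have hu₁' : u₁ < 2 * r → r - 1 + a ≤ t + u₁ := fun h => by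
    rcases le_abs.1 (hu₁ h) with h' | h'
    · linarith
    · exact absurd ⟨h, by linarith⟩ hneg₁
  have hu₂' : u₂ < 2 * r → r - 1 + a ≤ t + u₂ := fun h => by
    rcases le_abs.1 (hu₂ h) with h' | h'
    · linarith
    · exact absurd ⟨h, by linarith⟩ hneg₂
  exact .inl ⟨fun h => by linarith [hu₁' h], fun h => by linarith [hu₂' h],
    fun h => by linarith [hw₁' h], fun h => by linarith [hw₂' h],
    fun h h' => by linarith [hu₁' h, hw₁' h'], fun h h' => by linarith [hu₁' h, hw₂' h'],
    fun h h' => by linarith [hu₂' h, hw₁' h'], fun h h' => by linarith [hu₂' h, hw₂' h']⟩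

/-- The far visit at `-1 + wm` cannot precede `z`, since `z ≤ -1 + r`. Hence `z` comes at least `r +
b` before it, and `M ≤ b`. -/
theorem middle_le_of_far_visit (hM : M ≤ a + b - (8 - 2 * r))
    (ha' : a ≤ 8 - 2 * r) (hb : 0 < b) (hb' : b ≤ 8 - 2 * r) (hz : |z - -1| ≤ r)
    (pn : 0 ≤ p) (wn : 0 ≤ wm)
    (hp : p < 2 * r → r + b ≤ |z - (-1 - p)|) (hwm : r + b ≤ |z - (-1 + wm)|) :
    M ≤ 8 - 2 * r ∧ M ≤ wm ∧ (p < 2 * r → 2 * r + 2 * M ≤ p + wm) := by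
  obtain ⟨hz1, hz2⟩ := abs_le.1 hz
  have hw' : r + b ≤ wm - 1 - z := by
    rcases le_abs.1 hwm with h' | h' <;> linarith
  refine ⟨by linarith, by linarith, fun h => ?_⟩
  rcases le_abs.1 (hp h) with h' | h' <;> linarith

end

theorem PathData.total_le {y : ℝ → ℝ} {V₁ V₂ : Set ℝ} (h : PathData y V₁ V₂) {r : ℝ}
    (hr : 2 ≤ r) (hr4 : r ≤ 4) :
    (volume (interceptedStarts V₁ 0 (2 * r))).toReal +
      (volume (interceptedStarts V₂ 0 (2 * r))).toReal +
      (volume (interceptedStarts {s | y s = 6} (-1) (2 * r))).toReal +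
      (volume (interceptedStarts {s | y s = 6} 1 (2 * r))).toReal +
      (volume (visitedMiddle y r (-1))).toReal + (volume (visitedMiddle y r 1)).toReal ≤
    4 * r := by
  have hL : 0 ≤ 2 * r := by linarith
  obtain ⟨u₁, u1n, u1r, u1v, u1l⟩ := exists_last_visit h.closed₁ 0 hL
  obtain ⟨u₂, u2n, u2r, u2v, u2l⟩ := exists_last_visit h.closed₂ 0 hL
  obtain ⟨w₁, w1n, w1r, w1v, w1l⟩ := exists_next_visit h.closed₁ 0 hL
  obtain ⟨w₂, w2n, w2r, w2v, w2l⟩ := exists_next_visit h.closed₂ 0 hL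
  obtain ⟨p, pn, pr, pv, pl⟩ := exists_last_visit h.closed_far (-1) hL
  obtain ⟨wm, wmn, wmr, wmv, wml⟩ := exists_next_visit h.closed_far (-1) hL
  obtain ⟨up, upn, upr, upv, upl⟩ := exists_last_visit h.closed_far 1 hL
  obtain ⟨n, nn, nr, nv, nl⟩ := exists_next_visit h.closed_far 1 hL
  have I1 := volume_interceptedStarts_le V₁ 0 hL
  have I1' := volume_interceptedStarts_le_of_gap u1r w1r u1l w1l
  have I2 := volume_interceptedStarts_le V₂ 0 hL
  have I2' := volume_interceptedStarts_le_of_gap u2r w2r u2l w2l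
  have Jm := volume_interceptedStarts_le {s | y s = 6} (-1) hL
  have Jm' := volume_interceptedStarts_le_of_gap pr wmr pl wml
  have Jp := volume_interceptedStarts_le {s | y s = 6} 1 hL
  have Jp' := volume_interceptedStarts_le_of_gap upr nr upl nl
  have Mm := h.middle hr (-1)
  have Mp := h.middle hr 1
  generalize (volume (interceptedStarts V₁ 0 (2 * r))).toReal = i₁ at *
  generalize (volume (interceptedStarts V₂ 0 (2 * r))).toReal = i₂ at *
  generalize (volume (interceptedStarts {s | y s = 6} (-1) (2 * r))).toReal = jm at *
  generalize (volume (interceptedStarts {s | y s = 6} 1 (2 * r))).toReal = jp at *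
  generalize (volume (visitedMiddle y r (-1))).toReal = mm at *
  generalize (volume (visitedMiddle y r 1)).toReal = mp at *
  simp only [zero_sub, zero_add, mem_ofPred_eq] at u1v u2v w1v w2v pv wmv upv nv
  have sep : ∀ {x x' : ℝ}, x ∈ V₁ → x' ∈ V₂ → 2 ≤ |x - x'| := fun a b => h.separated _ a _ b
  have far₁ : ∀ {x x' : ℝ}, x ∈ V₁ → y x' = 6 → 7 ≤ |x' - x| := fun a b => h.far (.inl a) b
  have far₂ : ∀ {x x' : ℝ}, x ∈ V₂ → y x' = 6 → 7 ≤ |x' - x| := fun a b => h.far (.inr a) b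
  have huu : u₁ < 2 * r → u₂ < 2 * r → 2 ≤ |u₁ - u₂| := fun a b => by
    have := sep (u1v a) (u2v b)
    rwa [neg_sub_neg, abs_sub_comm] at this
  have hww : w₁ < 2 * r → w₂ < 2 * r → 2 ≤ |w₁ - w₂| := fun a b => sep (w1v a) (w2v b)
  -- The far visit must be the earlier one: in the opposite order the near visit would be at least
  -- `8 ≥ 2 * r` back.
  have before : ∀ {u x : ℝ}, 0 ≤ u → u < 2 * r → 0 ≤ x → 7 ≤ |(-1 - x) - -u| → u + 6 ≤ x := by
    intro u x h0 h1 h2 h3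
    rcases le_abs.1 h3 with h4 | h4 <;> linarith
  have after : ∀ {w x : ℝ}, 0 ≤ w → w < 2 * r → 0 ≤ x → 7 ≤ |(1 + x) - w| → w + 6 ≤ x := by
    intro u x h0 h1 h2 h3
    rcases le_abs.1 h3 with h4 | h4 <;> linarith
  have hpu₁ : p < 2 * r → u₁ < 2 * r → u₁ + 6 ≤ p := fun a b =>
    before u1n b pn (far₁ (u1v b) (pv a))
  have hpu₂ : p < 2 * r → u₂ < 2 * r → u₂ + 6 ≤ p := fun a b =>
    before u2n b pn (far₂ (u2v b) (pv a))
  have hnw₁ : n < 2 * r → w₁ < 2 * r → w₁ + 6 ≤ n := fun a b =>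
    after w1n b nn (far₁ (w1v b) (nv a))
  have hnw₂ : n < 2 * r → w₂ < 2 * r → w₂ + 6 ≤ n := fun a b =>
    after w2n b nn (far₂ (w2v b) (nv a))
  -- With a far visit in `[-1, 1]`, past and future decouple and contribute at most `2 * r` each,
  -- using `I ≤ (2r - u) + (2r - w)`.
  by_cases hin : ∃ v ∈ Icc (-1 : ℝ) 1, y v = 6
  · obtain ⟨v, ⟨hv1, hv2⟩, hv⟩ := hin
    have hwm2 : wm ≤ 2 := by linarith [wml v hv hv1]
    have hup2 : up ≤ 2 := by linarith [upl v hv hv2]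
    have hwm6 := wmv (by linarith)
    have hup6 := upv (by linarith)
    have key₁ : ∀ {u : ℝ}, 0 ≤ u → 7 ≤ |-1 + wm - -u| → 8 ≤ u + wm := by
      intro u h0 h1
      rcases le_abs.1 h1 with h4 | h4 <;> linarith
    have key₂ : ∀ {w : ℝ}, 0 ≤ w → 7 ≤ |1 - up - w| → 8 ≤ w + up := by
      intro u h0 h1
      rcases le_abs.1 h1 with h4 | h4 <;> linarith
    have minus := near_gain_le_of_far_visit (Mm := mm) hr4 u1r u2r pr hwm2 (by linarith) Jm huu
      (fun a => key₁ u1n (far₁ (u1v a) hwm6)) (fun a => key₁ u2n (far₂ (u2v a) hwm6)) hpu₁ hpu₂ (by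
        rcases Mm with hM | ⟨a, b, t, z, hM, -, ha', hb, hb', -, hz, -, hfar⟩
        · exact .inl hM
        · exact .inr (middle_le_of_far_visit hM ha' hb hb' hz pn wmn (fun a => hfar _ (pv a))
            (hfar _ hwm6)))
    have plus := near_gain_le_of_far_visit (Mm := mp) hr4 w1r w2r nr hup2 (by linarith) Jp hww
      (fun a => key₂ w1n (far₁ (w1v a) hup6)) (fun a => key₂ w2n (far₂ (w2v a) hup6)) hnw₁ hnw₂ (by
        rcases Mp with hM | ⟨a, b, t, z, hM, -, ha', hb, hb', -, hz, -, hfar⟩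
        · exact .inl hM
        · refine .inr (middle_le_of_far_visit (z := -z) hM ha' hb hb' ?_ nn upn (fun a => ?_) ?_)
          · rwa [neg_sub_neg, abs_sub_comm]
          · have := hfar _ (nv a)
            rwa [abs_sub_comm, show 1 + n - z = -z - (-1 - n) by ring] at this
          · have := hfar _ hup6
            rwa [abs_sub_comm, show 1 - up - z = -z - (-1 + up) by ring] at this)
    linarith
  · push Not at hin
    -- No far visit lies in `[-1, 1]`, so the first one after `-1` is also after `1`, two units
    -- further from `-1`.
    have hwm : 2 * r ≤ wm ∨ n + 2 ≤ wm := by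
      rcases wmr.lt_or_eq with h' | h'
      · right
        have h1 : (1 : ℝ) ≤ -1 + wm := by
          by_contra h2
          exact hin _ ⟨by linarith, by linarith⟩ (wmv h')
        linarith [nl _ (wmv h') h1]
      · exact .inl h'.ge
    have hup : 2 * r ≤ up ∨ p + 2 ≤ up := by
      rcases upr.lt_or_eq with h' | h'
      · right
        have h1 : 1 - up ≤ (-1 : ℝ) := by
          by_contra h2
          exact hin _ ⟨by linarith, by linarith⟩ (upv h')
        linarith [pl _ (upv h') h1]
      · exact .inl h'.ge
    have cross : ∀ {x x' d : ℝ}, 0 ≤ x → 0 ≤ x' → 0 < d → d ≤ |-x - x'| → d ≤ x + x' := by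
      intro x x' d h0 h1 h2 h3
      rcases le_abs.1 h3 with h4 | h4 <;> linarith
    refine visit_inequality_outer hr hr4 u1n u2n w1n w2n pn nn u1r u2r w1r w2r pr nr I1
      (by linarith) I2 (by linarith) (wm := wm) (up := up) (by linarith) (by linarith) Jm Jp hwm hup
      huu hww ?_ ?_ hpu₁ hpu₂ ?_ ?_ hnw₁ hnw₂ ?_ ?_ ?_ ?_
    · exact fun a b => cross u1n w2n (by norm_num) (sep (u1v a) (w2v b))
    · refine fun a b => cross u2n w1n (by norm_num) ?_
      have := sep (w1v b) (u2v a)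
      rwa [abs_sub_comm] at this
    · intro a b
      rcases le_abs.1 (far₁ (w1v b) (pv a)) with h4 | h4 <;> linarith
    · intro a b
      rcases le_abs.1 (far₂ (w2v b) (pv a)) with h4 | h4 <;> linarith
    · intro a b
      rcases le_abs.1 (far₁ (u1v b) (nv a)) with h4 | h4 <;> linarith
    · intro a b
      rcases le_abs.1 (far₂ (u2v b) (nv a)) with h4 | h4 <;> linarith
    · rcases Mm with hM | ⟨a, b, t, z, hM, ha, ha', hb, hb', ht, hz, hnear, hfar⟩
      · exact .inl hM
      · exact middleBound_of_visits hM ha ha' hb hb' ht hz u1n u2n w1n w2n pn nn huu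
          (fun h => hnear _ (.inl (u1v h))) (fun h => hnear _ (.inr (u2v h)))
          (fun h => hnear _ (.inl (w1v h))) (fun h => hnear _ (.inr (w2v h)))
          (fun h => hfar _ (pv h)) (fun h => hfar _ (nv h))
    · rcases Mp with hM | ⟨a, b, t, z, hM, ha, ha', hb, hb', ht, hz, hnear, hfar⟩
      · exact .inl hM
      -- The window around `1` is reduced to the one around `-1` by reversing time.
      · have flip : ∀ x x' : ℝ, |-x - x'| = |x - -x'| := fun x x' => by
          rw [← abs_neg]; congr 1; ring
        refine middleBound_of_visits (t := -t) (z := -z) hM ha ha' hb hb' ?_ ?_ w1n w2n u1n u2n nn pn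
          hww (fun h => ?_) (fun h => ?_) (fun h => ?_) (fun h => ?_) (fun h => ?_) (fun h => ?_) <;>
        rw [flip]
        · rwa [neg_neg]
        · rwa [neg_neg]
        · simpa using hnear _ (.inl (w1v h))
        · simpa using hnear _ (.inr (w2v h))
        · exact hnear _ (.inl (u1v h))
        · exact hnear _ (.inr (u2v h))
        · have := hfar _ (nv h)
          rwa [show -(-1 - n) = 1 + n by ring]
        · have := hfar _ (pv h)
          rwa [show -(1 + p) = -1 - p by ring]

/-! ## Stars -/

section Star

variable {k : ℕ} {ℓ : Fin k → ℝ≥0}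

theorem Star.dist_eq (x y : Star ℓ) : dist x y = ∑ i, |x.1 i - y.1 i| := by
  rw [Subtype.dist_eq, PiLp.dist_eq_of_L1]
  simp [Real.dist_eq]

theorem Star.abs_coord_sub_le (x y : Star ℓ) (i : Fin k) : |x.1 i - y.1 i| ≤ dist x y := by
  rw [Star.dist_eq]
  exact Finset.single_le_sum (f := fun i => |x.1 i - y.1 i|) (fun _ _ => abs_nonneg _)
    (Finset.mem_univ i)

theorem Star.continuous_coord (i : Fin k) : Continuous fun x : Star ℓ => x.1 i :=
  (LipschitzWith.of_dist_le_mul (K := 1) fun x y => by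
    simpa [Real.dist_eq] using Star.abs_coord_sub_le x y i).continuous

theorem Star.ext_coord {x y : Star ℓ} (h : ∀ i, x.1 i = y.1 i) : x = y :=
  Subtype.ext (PiLp.ext h)

variable (ℓ) in
/-- The point of arc `i` at distance `t` from the center (`t` is clipped to `[0, ℓ i]`). -/
def arcPoint (i : Fin k) (t : ℝ) : Star ℓ :=
  ⟨WithLp.toLp 1 (Pi.single i (max 0 (min t (ℓ i)))), by
    refine ⟨fun j => ?_, fun j m hjm => ?_⟩
    · by_cases h : j = i
      · subst h; simp
      · simp [h]
    · by_cases h : j = i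
      · right; subst h; simp [Ne.symm hjm]
      · left; simp [h]⟩

theorem arcPoint_coord_of_ne {i j : Fin k} (h : j ≠ i) (t : ℝ) : (arcPoint ℓ i t).1 j = 0 := by
  simp [arcPoint, h]

theorem arcPoint_coord_self (i : Fin k) (t : ℝ) :
    (arcPoint ℓ i t).1 i = max 0 (min t (ℓ i)) := by
  simp [arcPoint]

theorem arcPoint_coord {i : Fin k} {t : ℝ} (ht : t ∈ Icc (0 : ℝ) (ℓ i)) :
    (arcPoint ℓ i t).1 i = t := by
  rw [arcPoint_coord_self, min_eq_left ht.2, max_eq_right ht.1]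

theorem leafNode_eq_arcPoint (i : Fin k) : leafNode ℓ i = arcPoint ℓ i (ℓ i) := by
  apply Star.ext_coord
  intro j
  by_cases h : j = i
  · subst h
    simp [leafNode, arcPoint]
  · rw [arcPoint_coord_of_ne h]
    simp [leafNode, h]

theorem Star.coord_mem (x : Star ℓ) (i : Fin k) : x.1 i ∈ Icc (0 : ℝ) (ℓ i) := x.2.1 i

theorem Star.coord_eq_zero_of_pos {x : Star ℓ} {i j : Fin k} (h : 0 < x.1 i) (hj : j ≠ i) :
    x.1 j = 0 := by
  rcases x.2.2 i j hj.symm with h' | h'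
  · exact absurd h' h.ne'
  · exact h'

theorem Star.eq_arcPoint {x : Star ℓ} {i : Fin k} (h : ∀ j, j ≠ i → x.1 j = 0) :
    x = arcPoint ℓ i (x.1 i) := by
  apply Star.ext_coord
  intro j
  by_cases hj : j = i
  · subst hj
    rw [arcPoint_coord (x.coord_mem j)]
  · rw [arcPoint_coord_of_ne hj, h j hj]

theorem Star.eq_arcPoint_of_pos {x : Star ℓ} {i : Fin k} (h : 0 < x.1 i) :
    x = arcPoint ℓ i (x.1 i) :=
  Star.eq_arcPoint fun _ hj => Star.coord_eq_zero_of_pos h hj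

theorem Star.exists_eq_arcPoint [NeZero k] (x : Star ℓ) :
    ∃ i, ∃ t ∈ Icc (0 : ℝ) (ℓ i), x = arcPoint ℓ i t := by
  by_cases h : ∃ i, 0 < x.1 i
  · obtain ⟨i, hi⟩ := h
    exact ⟨i, _, x.coord_mem i, Star.eq_arcPoint_of_pos hi⟩
  · push Not at h
    exact ⟨0, _, x.coord_mem 0, Star.eq_arcPoint fun j _ => le_antisymm (h j) (x.coord_mem j).1⟩

theorem dist_arcPoint_self {i : Fin k} {s t : ℝ} (hs : s ∈ Icc (0 : ℝ) (ℓ i))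
    (ht : t ∈ Icc (0 : ℝ) (ℓ i)) : dist (arcPoint ℓ i s) (arcPoint ℓ i t) = |s - t| := by
  rw [Star.dist_eq, Finset.sum_eq_single i]
  · rw [arcPoint_coord hs, arcPoint_coord ht]
  · intro j _ hj
    rw [arcPoint_coord_of_ne hj, arcPoint_coord_of_ne hj, sub_zero, abs_zero]
  · simp

theorem dist_arcPoint_of_ne {i j : Fin k} (hij : i ≠ j) {s t : ℝ} (hs : s ∈ Icc (0 : ℝ) (ℓ i))
    (ht : t ∈ Icc (0 : ℝ) (ℓ j)) : dist (arcPoint ℓ i s) (arcPoint ℓ j t) = s + t := by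
  rw [Star.dist_eq, Finset.sum_eq_add (M := ℝ) i j hij]
  · rw [arcPoint_coord hs, arcPoint_coord ht, arcPoint_coord_of_ne hij, arcPoint_coord_of_ne hij.symm,
      sub_zero, zero_sub, abs_neg, abs_of_nonneg hs.1, abs_of_nonneg ht.1]
  · rintro m - ⟨h1, h2⟩
    rw [arcPoint_coord_of_ne h1, arcPoint_coord_of_ne h2, sub_zero, abs_zero]
  · simp
  · simp

theorem arcPoint_zero (i j : Fin k) : arcPoint ℓ i 0 = arcPoint ℓ j 0 := by
  apply Star.ext_coord
  have : ∀ i m : Fin k, (arcPoint ℓ i 0).1 m = 0 := by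
    intro i m
    by_cases h : m = i
    · subst h
      exact arcPoint_coord ⟨le_rfl, (ℓ m).2⟩
    · exact arcPoint_coord_of_ne h _
  intro m
  rw [this, this]

theorem continuous_arcPoint (i : Fin k) : Continuous (arcPoint ℓ i) := by
  refine (LipschitzWith.of_dist_le_mul (K := 1) fun s t => ?_).continuous
  have hclip : ∀ t, arcPoint ℓ i t = arcPoint ℓ i (max 0 (min t (ℓ i))) := by
    intro t
    simp [arcPoint]
  rw [hclip s, hclip t, dist_arcPoint_self (by simp) (by simp)]
  simp only [NNReal.coe_one, one_mul, Real.dist_eq]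
  refine (abs_max_sub_max_le_max _ _ _ _).trans ?_
  rw [sub_self, abs_zero, max_eq_right (abs_nonneg _)]
  refine (abs_min_sub_min_le_max _ _ _ _).trans ?_
  rw [sub_self, abs_zero, max_eq_left (abs_nonneg _)]

theorem Star.exists_geodesic [NeZero k] (x y : Star ℓ) :
    ∃ γ : ℝ → Star ℓ, γ 0 = x ∧ γ (dist x y) = y ∧
      ∀ s ∈ Icc 0 (dist x y), ∀ t ∈ Icc 0 (dist x y), dist (γ s) (γ t) = |s - t| := by
  obtain ⟨i, a, ha, rfl⟩ := x.exists_eq_arcPoint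
  obtain ⟨j, b, hb, rfl⟩ := y.exists_eq_arcPoint
  by_cases hij : i = j
  · subst hij
    rw [dist_arcPoint_self ha hb]
    rcases le_total a b with h | h
    · rw [abs_of_nonpos (by linarith)]
      refine ⟨fun s => arcPoint ℓ i (a + s), by simp, by simp, fun s hs t ht => ?_⟩
      rw [dist_arcPoint_self ⟨by linarith [ha.1, hs.1], by linarith [hb.2, hs.2]⟩
        ⟨by linarith [ha.1, ht.1], by linarith [hb.2, ht.2]⟩]
      congr 1; ring
    · rw [abs_of_nonneg (by linarith)]
      refine ⟨fun s => arcPoint ℓ i (a - s), by simp, by simp, fun s hs t ht => ?_⟩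
      rw [dist_arcPoint_self ⟨by linarith [hb.1, hs.2], by linarith [ha.2, hs.1]⟩
        ⟨by linarith [hb.1, ht.2], by linarith [ha.2, ht.1]⟩, abs_sub_comm s t]
      congr 1; ring
  · rw [dist_arcPoint_of_ne hij ha hb]
    refine ⟨fun s => if s ≤ a then arcPoint ℓ i (a - s) else arcPoint ℓ j (s - a), ?_, ?_, ?_⟩
    · simp [ha.1]
    · by_cases h : b = 0
      · subst h
        simp [arcPoint_zero i j]
      · have : ¬ a + b ≤ a := by
          have := lt_of_le_of_ne hb.1 (Ne.symm h)
          linarith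
        simp [this]
    · intro s hs t ht
      have left : ∀ {s}, s ∈ Icc 0 (a + b) → s ≤ a → a - s ∈ Icc (0 : ℝ) (ℓ i) :=
        fun hs h => ⟨by linarith, by linarith [ha.2, hs.1]⟩
      have right : ∀ {s}, s ∈ Icc 0 (a + b) → ¬ s ≤ a → s - a ∈ Icc (0 : ℝ) (ℓ j) :=
        fun hs h => ⟨by linarith, by linarith [hb.2, hs.2]⟩
      dsimp only
      split_ifs with h1 h2 h2
      · rw [dist_arcPoint_self (left hs h1) (left ht h2), abs_sub_comm s t]
        congr 1; ring
      · rw [dist_arcPoint_of_ne hij (left hs h1) (right ht h2), abs_of_nonpos (by linarith)]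
        ring
      · rw [dist_comm, dist_arcPoint_of_ne hij (left ht h2) (right hs h1),
          abs_of_nonneg (by linarith)]
        ring
      · rw [dist_arcPoint_self (right hs h1) (right ht h2)]
        congr 1; ring

/-- Some coordinate is positive somewhere on an injective loop, and a positive coordinate determines
the point. Leaving a maximum of this coordinate in both directions, the loop takes each slightly
smaller value twice, hence visits a point twice. -/
theorem Star.not_injective_of_circle [NeZero k] (γ : Circle → Star ℓ) (hγ : Continuous γ) :
    ¬ Function.Injective γ := by
  intro hinj
  obtain ⟨i, z, hz⟩ : ∃ i z, 0 < (γ z).1 i := by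
    by_contra! h
    have h0 : ∀ z i, (γ z).1 i = 0 := fun z i => le_antisymm (h i z) ((γ z).coord_mem i).1
    have : (1 : Circle) = -1 := hinj (Star.ext_coord fun i => by rw [h0, h0])
    have := congrArg (fun z : Circle => (z : ℂ).re) this
    norm_num at this
  have hcont : Continuous fun z => (γ z).1 i := (Star.continuous_coord i).comp hγ
  obtain ⟨z₀, -, hmax⟩ := isCompact_univ.exists_isMaxOn (univ_nonempty (α := Circle))
    hcont.continuousOn
  have hmax' : ∀ z, (γ z).1 i ≤ (γ z₀).1 i := fun z => hmax (mem_univ z)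
  have hpos : 0 < (γ z₀).1 i := hz.trans_le (hmax' z)
  have huniq : ∀ {z z'}, 0 < (γ z).1 i → (γ z).1 i = (γ z').1 i → z = z' := by
    intro z z' h h'
    apply hinj
    exact (Star.eq_arcPoint_of_pos h).trans
      ((congrArg _ h').trans (Star.eq_arcPoint_of_pos (h' ▸ h)).symm)
  set g : ℝ → ℝ := fun θ => (γ (z₀ * Circle.exp θ)).1 i with hg
  have hgc : Continuous g := by fun_prop
  have g0 : g 0 = (γ z₀).1 i := by simp [hg]
  have g2 : g (2 * Real.pi) = (γ z₀).1 i := by simp [hg]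
  have hlt : g Real.pi < (γ z₀).1 i := by
    refine lt_of_le_of_ne (hmax' _) fun h => ?_
    have := huniq hpos h.symm
    rw [left_eq_mul] at this
    have h' := congrArg (fun z : Circle => (z : ℂ).re) this
    norm_num at h'
  -- The level lies above the value at the antipode, so that each half circle crosses it, and above
  -- `0`, so that it determines a point.
  obtain ⟨v, hv1, hv2⟩ := exists_between (max_lt hlt hpos)
  obtain ⟨hv3, hv4⟩ := max_lt_iff.1 hv1
  have hpi := Real.pi_pos
  obtain ⟨θ₁, ⟨h1, h1'⟩, e1⟩ := intermediate_value_Icc' hpi.le hgc.continuousOn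
    ⟨hv3.le, hv2.le.trans_eq g0.symm⟩
  obtain ⟨θ₂, ⟨h2, h2'⟩, e2⟩ := intermediate_value_Icc (by linarith : Real.pi ≤ 2 * Real.pi)
    hgc.continuousOn ⟨hv3.le, hv2.le.trans_eq g2.symm⟩
  have h := huniq (z := z₀ * Circle.exp θ₁) (z' := z₀ * Circle.exp θ₂) (hv4.trans_eq e1.symm)
    (e1.trans e2.symm)
  have h0 : 0 < θ₁ := lt_of_le_of_ne h1 fun h => by
    rw [← h, g0] at e1
    exact hv2.ne' e1
  have h3 : θ₁ ≠ Real.pi := fun h => by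
    rw [h] at e1
    exact hv3.ne e1
  have h4 : θ₂ < 2 * Real.pi := lt_of_le_of_ne h2' fun h => by
    rw [h, g2] at e2
    exact hv2.ne' e2
  -- The angles differ by `2 * π * m`, but `θ₂ - θ₁` lies strictly between `0` and `2 * π`.
  obtain ⟨m, hm⟩ := Circle.exp_eq_exp.1 (mul_left_cancel h)
  have h5 : θ₁ < Real.pi := lt_of_le_of_ne h1' h3
  have hm1 : (m : ℝ) < 0 := by
    by_contra! hm0
    nlinarith
  have hm2 : -1 < (m : ℝ) := by
    by_contra! hm0
    nlinarith
  have : m < 0 := by exact_mod_cast hm1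
  have : -1 < m := by exact_mod_cast hm2
  omega

theorem Star.isTreeNetwork [NeZero k] (ℓ : Fin k → ℝ≥0) : IsTreeNetwork (Star ℓ) where
  nonempty := ⟨arcPoint ℓ 0 0⟩
  geodesic := Star.exists_geodesic
  finite := by
    refine ⟨range (fun i => arcPoint ℓ i 0) ∪ range (leafNode ℓ),
      (finite_range _).union (finite_range _), fun x => ?_⟩
    obtain ⟨i, t, ht, rfl⟩ := x.exists_eq_arcPoint
    refine ⟨_, .inl ⟨i, rfl⟩, _, .inr ⟨i, rfl⟩, ?_⟩
    have h0 : (0 : ℝ) ∈ Icc (0 : ℝ) (ℓ i) := ⟨le_rfl, (ℓ i).2⟩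
    have h1 : (ℓ i : ℝ) ∈ Icc (0 : ℝ) (ℓ i) := ⟨(ℓ i).2, le_rfl⟩
    rw [leafNode_eq_arcPoint, dist_arcPoint_self h0 ht, dist_arcPoint_self ht h1,
      dist_arcPoint_self h0 h1, abs_of_nonpos (by linarith [ht.1]),
      abs_of_nonpos (by linarith [ht.2]), abs_of_nonpos (by linarith [h1.1])]
    ring
  no_circuit := Star.not_injective_of_circle

/-! ### Length on a star -/

theorem length_arcPoint_image {i : Fin k} {s : Set ℝ} (hs : s ⊆ Icc (0 : ℝ) (ℓ i)) :
    length (Star ℓ) (arcPoint ℓ i '' s) = volume s := by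
  have hiso : Isometry fun t : Icc (0 : ℝ) (ℓ i) => arcPoint ℓ i t :=
    Isometry.of_dist_eq fun a b => by
      rw [dist_arcPoint_self a.2 b.2, Subtype.dist_eq, Real.dist_eq]
  have h1 : arcPoint ℓ i '' s =
      (fun t : Icc (0 : ℝ) (ℓ i) => arcPoint ℓ i t) '' (Subtype.val ⁻¹' s) := by
    rw [show (fun t : Icc (0 : ℝ) (ℓ i) => arcPoint ℓ i t) = arcPoint ℓ i ∘ Subtype.val from rfl,
      image_comp, Subtype.image_preimage_coe, inter_eq_self_of_subset_right hs]
  rw [length, h1, hiso.hausdorffMeasure_image (.inl zero_le_one),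
    ← isometry_subtype_coe.hausdorffMeasure_image (.inl zero_le_one), Subtype.image_preimage_coe,
    inter_eq_self_of_subset_right hs, hausdorffMeasure_real]

/-- The value `0` has to be excluded: this coordinate vanishes on all the other arcs. -/
theorem setOf_coord_mem_eq_image {i : Fin k} {s : Set ℝ} (hs : s ⊆ Ioc (0 : ℝ) (ℓ i)) :
    {x : Star ℓ | x.1 i ∈ s} = arcPoint ℓ i '' s := by
  ext x
  constructor
  · intro hx
    exact ⟨x.1 i, hx, (Star.eq_arcPoint_of_pos (hs hx).1).symm⟩
  · rintro ⟨t, ht, rfl⟩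
    change (arcPoint ℓ i t).1 i ∈ s
    rwa [arcPoint_coord ⟨(hs ht).1.le, (hs ht).2⟩]

theorem length_setOf_coord_mem {i : Fin k} {s : Set ℝ} (hs : s ⊆ Ioc (0 : ℝ) (ℓ i)) :
    length (Star ℓ) {x | x.1 i ∈ s} = volume s := by
  rw [setOf_coord_mem_eq_image hs, length_arcPoint_image (hs.trans Ioc_subset_Icc_self)]

instance : NullSingletonClass (length (Star ℓ)) := by
  exact Measure.nullSingletonClass_hausdorff _ zero_lt_one

end Star

/-! ### Total length, components and the extremity set of a star -/

section Star

variable {k : ℕ} {ℓ : Fin k → ℝ≥0}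

theorem Star.measurable_coord (i : Fin k) : Measurable fun x : Star ℓ => x.1 i :=
  (Star.continuous_coord i).measurable

theorem totalLength_star [NeZero k] (ℓ : Fin k → ℝ≥0) :
    totalLength (Star ℓ) = ∑ i, (ℓ i : ℝ≥0∞) := by
  have hdisj : Pairwise (Function.onFun Disjoint
      fun i : Fin k => {x : Star ℓ | x.1 i ∈ Ioc (0 : ℝ) (ℓ i)}) := by
    intro i j hij
    refine Set.disjoint_left.2 fun x hx hx' => ?_
    have := Star.coord_eq_zero_of_pos (x := x) hx.1 hij.symm
    exact hx'.1.ne' this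
  have hae : (univ : Set (Star ℓ)) =ᵐ[length (Star ℓ)]
      ⋃ i : Fin k, {x : Star ℓ | x.1 i ∈ Ioc (0 : ℝ) (ℓ i)} := by
    have h0 : length (Star ℓ) {arcPoint ℓ 0 0} = 0 := measure_singleton _
    refine (ae_eq_univ.2 (measure_mono_null (fun x hx => ?_) h0)).symm
    obtain ⟨i, t, ht, rfl⟩ := x.exists_eq_arcPoint
    rcases ht.1.lt_or_eq with h | rfl
    · exact absurd (mem_iUnion.2 ⟨i, by
        change (arcPoint ℓ i t).1 i ∈ Ioc (0 : ℝ) (ℓ i)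
        rw [arcPoint_coord ht]
        exact ⟨h, ht.2⟩⟩) hx
    · exact arcPoint_zero i 0
  rw [totalLength, measure_congr hae,
    measure_iUnion hdisj fun i => Star.measurable_coord i measurableSet_Ioc, tsum_fintype]
  refine Finset.sum_congr rfl fun i _ => ?_
  rw [length_setOf_coord_mem Subset.rfl, Real.volume_Ioc, sub_zero, ENNReal.ofReal_coe_nnreal]

theorem isRegularPoint_of_coord_mem_Ioo {x : Star ℓ} {i : Fin k} (hx : x.1 i ∈ Ioo (0 : ℝ) (ℓ i)) :
    IsRegularPoint x := by
  have hℓ : (0 : ℝ) < ℓ i := hx.1.trans hx.2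
  have hmem : ∀ s ∈ Ioo (0 : ℝ) 1, s * ℓ i ∈ Ioo (0 : ℝ) (ℓ i) := fun s hs =>
    ⟨mul_pos hs.1 hℓ, by nlinarith [hs.2]⟩
  have hcoord : ∀ s ∈ Ioo (0 : ℝ) 1, (arcPoint ℓ i (s * ℓ i)).1 i = s * ℓ i := fun s hs =>
    arcPoint_coord (Ioo_subset_Icc_self (hmem s hs))
  refine ⟨{z | z.1 i ∈ Ioo (0 : ℝ) (ℓ i)}, isOpen_Ioo.preimage (Star.continuous_coord i), hx, ⟨?_⟩⟩
  exact
    { toFun := fun z => ⟨z.1.1 i / ℓ i, div_pos z.2.1 hℓ, (div_lt_one hℓ).2 z.2.2⟩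
      invFun := fun s => ⟨arcPoint ℓ i (s.1 * ℓ i), by
        change (arcPoint ℓ i (s.1 * ℓ i)).1 i ∈ Ioo (0 : ℝ) (ℓ i)
        rw [hcoord s.1 s.2]
        exact hmem s.1 s.2⟩
      left_inv := fun z => by
        apply Subtype.ext
        dsimp only
        rw [div_mul_cancel₀ _ hℓ.ne']
        exact (Star.eq_arcPoint_of_pos z.2.1).symm
      right_inv := fun s => by
        apply Subtype.ext
        dsimp only
        rw [hcoord s.1 s.2, mul_div_cancel_right₀ _ hℓ.ne']
      continuous_toFun :=
        (((Star.continuous_coord i).comp continuous_subtype_val).div_const _).subtype_mk _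
      continuous_invFun := by
        refine Continuous.subtype_mk ?_ _
        exact (continuous_arcPoint i).comp (continuous_subtype_val.mul continuous_const) }

theorem Star.eq_of_coord_eq {x y : Star ℓ} {i : Fin k} (hx : 0 < x.1 i) (h : x.1 i = y.1 i) :
    x = y :=
  (Star.eq_arcPoint_of_pos hx).trans
    ((congrArg _ h).trans (Star.eq_arcPoint_of_pos (h ▸ hx)).symm)

theorem Star.coord_ne_of_mem_component {x y z : Star ℓ} {i : Fin k} (hx : 0 < x.1 i)
    (hz : z ∈ connectedComponentIn {x}ᶜ y) : z.1 i ≠ x.1 i := by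
  intro h
  exact connectedComponentIn_subset _ _ hz (Star.eq_of_coord_eq hx h.symm).symm

/-- The coordinate has an order-connected image on a component, and it cannot pass `x.1 i`, because
`x` is the only point with this positive coordinate. -/
theorem Star.component_outer {x y : Star ℓ} {i : Fin k} (hx : 0 < x.1 i) (hy : x.1 i < y.1 i) :
    connectedComponentIn {x}ᶜ y = {z | z.1 i ∈ Ioc (x.1 i) (ℓ i)} := by
  have hyx : y ∈ ({x}ᶜ : Set (Star ℓ)) := fun h => hy.ne' (congrArg (fun z : Star ℓ => z.1 i) h)
  apply Subset.antisymm
  · intro z hz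
    refine ⟨?_, (z.coord_mem i).2⟩
    by_contra! h
    obtain ⟨w, hw, hwx⟩ := (isPreconnected_connectedComponentIn (x := y) (F := {x}ᶜ)).image _
      (Star.continuous_coord i).continuousOn |>.ordConnected.out (mem_image_of_mem _ hz)
      (mem_image_of_mem _ (mem_connectedComponentIn hyx)) ⟨h, hy.le⟩
    exact Star.coord_ne_of_mem_component hx hw hwx
  · refine IsPreconnected.subset_connectedComponentIn ?_ ⟨hy, (y.coord_mem i).2⟩ fun z hz h => ?_
    · rw [setOf_coord_mem_eq_image (Ioc_subset_Ioc_left hx.le)]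
      exact isPreconnected_Ioc.image _ (continuous_arcPoint i).continuousOn
    · exact hz.1.ne' (congrArg (fun z : Star ℓ => z.1 i) h)

theorem Star.component_inner [NeZero k] {x y : Star ℓ} {i : Fin k} (hx : 0 < x.1 i)
    (hy : y.1 i < x.1 i) :
    connectedComponentIn {x}ᶜ y = {z | z.1 i ∈ Icc (x.1 i) (ℓ i)}ᶜ := by
  have hyx : y ∈ ({x}ᶜ : Set (Star ℓ)) := fun h => hy.ne (congrArg (fun z : Star ℓ => z.1 i) h)
  apply Subset.antisymm
  · intro z hz h
    obtain ⟨w, hw, hwx⟩ := (isPreconnected_connectedComponentIn (x := y) (F := {x}ᶜ)).image _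
      (Star.continuous_coord i).continuousOn |>.ordConnected.out
      (mem_image_of_mem _ (mem_connectedComponentIn hyx)) (mem_image_of_mem _ hz) ⟨hy.le, h.1⟩
    exact Star.coord_ne_of_mem_component hx hw hwx
  · refine IsPreconnected.subset_connectedComponentIn ?_ (fun h => hy.not_ge h.1) fun z hz h => ?_
    · refine isPreconnected_of_forall (arcPoint ℓ 0 0) fun z hz => ?_
      have hz' : z.1 i < x.1 i := by
        by_contra! h
        exact hz ⟨h, (z.coord_mem i).2⟩
      obtain ⟨j, t, ht, rfl⟩ := z.exists_eq_arcPoint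
      refine ⟨arcPoint ℓ j '' Icc 0 t, ?_, ⟨0, ⟨le_rfl, ht.1⟩, arcPoint_zero j 0⟩,
        ⟨t, ⟨ht.1, le_rfl⟩, rfl⟩,
        isPreconnected_Icc.image _ (continuous_arcPoint j).continuousOn⟩
      rintro _ ⟨s, hs, rfl⟩ ⟨h, -⟩
      by_cases hij : i = j
      · subst hij
        rw [arcPoint_coord ht] at hz'
        rw [arcPoint_coord ⟨hs.1, hs.2.trans ht.2⟩] at h
        linarith [hs.2]
      · rw [arcPoint_coord_of_ne hij] at h
        linarith
    · rw [mem_singleton_iff] at h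
      subst h
      exact hz ⟨le_rfl, (z.coord_mem i).2⟩

/-- An interior point of an arc is regular and cuts the star into the outer segment of length `ℓ i -
x.1 i` and the rest. -/
theorem mem_extremitySet_iff [NeZero k] {x : Star ℓ} {i : Fin k}
    (hx : x.1 i ∈ Ioo (0 : ℝ) (ℓ i)) (α : ℝ) :
    x ∈ extremitySet (Star ℓ) α ↔
      ENNReal.ofReal (ℓ i - x.1 i) < ENNReal.ofReal (α / 2) ∨
        totalLength (Star ℓ) - ENNReal.ofReal (ℓ i - x.1 i) < ENNReal.ofReal (α / 2) := by
  have houter : length (Star ℓ) {z | z.1 i ∈ Ioc (x.1 i) (ℓ i)} =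
      ENNReal.ofReal (ℓ i - x.1 i) := by
    rw [length_setOf_coord_mem (Ioc_subset_Ioc_left hx.1.le), Real.volume_Ioc]
  have hinner : length (Star ℓ) {z | z.1 i ∈ Icc (x.1 i) (ℓ i)}ᶜ =
      totalLength (Star ℓ) - ENNReal.ofReal (ℓ i - x.1 i) := by
    have h : length (Star ℓ) {z | z.1 i ∈ Icc (x.1 i) (ℓ i)} = ENNReal.ofReal (ℓ i - x.1 i) := by
      rw [length_setOf_coord_mem (fun t ht => ⟨hx.1.trans_le ht.1, ht.2⟩), Real.volume_Icc]
    have hm : MeasurableSet {z : Star ℓ | z.1 i ∈ Icc (x.1 i) (ℓ i)} :=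
      Star.measurable_coord i measurableSet_Icc
    rw [measure_compl hm (h ▸ ENNReal.ofReal_ne_top), h,
      totalLength]
  constructor
  · rintro ⟨-, y, hyx, hy⟩
    rcases lt_trichotomy (y.1 i) (x.1 i) with h | h | h
    · rw [Star.component_inner hx.1 h, hinner] at hy
      exact .inr hy
    · exact absurd (Star.eq_of_coord_eq hx.1 h.symm).symm hyx
    · rw [Star.component_outer hx.1 h, houter] at hy
      exact .inl hy
  · intro h
    refine ⟨isRegularPoint_of_coord_mem_Ioo hx, ?_⟩
    rcases h with h | h
    · have hy : x.1 i < (arcPoint ℓ i (ℓ i)).1 i := by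
        exact hx.2.trans_eq (arcPoint_coord ⟨(ℓ i).2, le_rfl⟩).symm
      refine ⟨arcPoint ℓ i (ℓ i), fun h' => hy.ne' (by rw [h']), ?_⟩
      rwa [Star.component_outer hx.1 hy, houter]
    · have hy : (arcPoint ℓ i 0).1 i < x.1 i := by
        exact (arcPoint_coord ⟨le_rfl, (ℓ i).2⟩).trans_lt hx.1
      refine ⟨arcPoint ℓ i 0, fun h' => hy.ne (by rw [h']), ?_⟩
      rwa [Star.component_inner hx.1 hy, hinner]

end Star

/-! ## The star with arcs of lengths 6, 1, 1 -/

theorem totalLength_star611 : totalLength Star611 = 8 := by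
  rw [totalLength_star, Fin.sum_univ_three]
  simp
  norm_num

theorem dist_star611_le (x y : Star611) : dist x y ≤ 7 := by
  obtain ⟨i, s, hs, rfl⟩ := x.exists_eq_arcPoint
  obtain ⟨j, t, ht, rfl⟩ := y.exists_eq_arcPoint
  by_cases hij : i = j
  · subst hij
    rw [dist_arcPoint_self hs ht, abs_le]
    have : ((![6, 1, 1] : Fin 3 → ℝ≥0) i : ℝ) ≤ 6 := by
      fin_cases i <;> simp
    constructor <;> linarith [hs.1, hs.2, ht.1, ht.2]
  · rw [dist_arcPoint_of_ne hij hs ht]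
    have : ((![6, 1, 1] : Fin 3 → ℝ≥0) i : ℝ) + ((![6, 1, 1] : Fin 3 → ℝ≥0) j : ℝ) ≤ 7 := by
      fin_cases i <;> fin_cases j <;> simp at hij ⊢ <;> norm_num
    linarith [hs.2, ht.2]

theorem dist_leafNode {k : ℕ} {ℓ : Fin k → ℝ≥0} {i j : Fin k} (hij : i ≠ j) :
    dist (leafNode ℓ i) (leafNode ℓ j) = ℓ i + ℓ j := by
  rw [leafNode_eq_arcPoint, leafNode_eq_arcPoint]
  exact dist_arcPoint_of_ne hij ⟨(ℓ i).2, le_rfl⟩ ⟨(ℓ j).2, le_rfl⟩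

theorem diam_star611 : Metric.diam (univ : Set Star611) = 7 := by
  have hb : Bornology.IsBounded (univ : Set Star611) :=
    Metric.isBounded_iff.2 ⟨7, fun x _ y _ => dist_star611_le x y⟩
  refine le_antisymm (Metric.diam_le_of_forall_dist_le (by norm_num)
    fun x _ y _ => dist_star611_le x y) ?_
  have h : dist (leafNode ![6, 1, 1] 0 : Star611) (leafNode ![6, 1, 1] 1) = 7 := by
    rw [dist_leafNode (by decide)]
    simp
    norm_num
  exact h ▸ Metric.dist_le_diam_of_mem hb (mem_univ _) (mem_univ _)

/-- The part of the long arc that is, up to finitely many points, the complement of the extremity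
set. -/
def middlePart (α : ℝ) : Set Star611 :=
  {x | x.1 0 ∈ Ioc (α / 2 - 2) (6 - α / 2)}

theorem measurableSet_middlePart (α : ℝ) : MeasurableSet (middlePart α) :=
  Star.measurable_coord 0 measurableSet_Ioc

theorem ae_mem_extremitySet_iff {α : ℝ} (hα : 4 ≤ α) :
    ∀ᵐ x ∂length Star611, x ∈ extremitySet Star611 α ↔ x ∉ middlePart α := by
  -- The center and the leaves are not covered by `mem_extremitySet_iff`, and at coordinate `α / 2 -
  -- 2` the half-open `middlePart` differs from the complement of `E`. Finitely many points are
  -- null.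
  have hfin : ({arcPoint _ 0 0, arcPoint _ 0 (α / 2 - 2), leafNode _ 0, leafNode _ 1, leafNode _ 2} :
      Set Star611).Finite := by simp
  filter_upwards [hfin.countable.ae_notMem (length Star611)] with x hx
  simp only [mem_insert_iff, mem_singleton_iff, not_or] at hx
  obtain ⟨h0, h1, l0, l1, l2⟩ := hx
  obtain ⟨i, t, ht, rfl⟩ := x.exists_eq_arcPoint
  have ht0 : 0 < t := ht.1.lt_of_ne fun h => h0 (h ▸ arcPoint_zero i 0)
  have htℓ : t < ((![6, 1, 1] : Fin 3 → ℝ≥0) i : ℝ) := ht.2.lt_of_ne fun h => by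
    rw [h, ← leafNode_eq_arcPoint] at l0 l1 l2
    fin_cases i
    · exact l0 rfl
    · exact l1 rfl
    · exact l2 rfl
  rw [mem_extremitySet_iff (i := i) (by rw [arcPoint_coord ht]; exact ⟨ht0, htℓ⟩),
    arcPoint_coord ht, totalLength_star611, middlePart, mem_ofPred_eq,
    show (8 : ℝ≥0∞) = ENNReal.ofReal 8 by simp, ← ENNReal.ofReal_sub _ (by linarith),
    ENNReal.ofReal_lt_ofReal_iff (by linarith), ENNReal.ofReal_lt_ofReal_iff (by linarith)]
  by_cases hi : i = 0
  · subst hi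
    rw [arcPoint_coord ht]
    have htα : t ≠ α / 2 - 2 := fun h => h1 (by rw [h])
    simp only [Matrix.cons_val_zero, mem_Ioc, not_and_or, not_lt, not_le]
    norm_num
    constructor
    · rintro (h | h)
      · right; linarith
      · left; linarith
    · rintro (h | h)
      · right
        have := h.lt_of_ne htα
        linarith
      · left; linarith
  · rw [arcPoint_coord_of_ne (Ne.symm hi)]
    have hℓ : ((![6, 1, 1] : Fin 3 → ℝ≥0) i : ℝ) = 1 := by
      fin_cases i <;> simp at hi ⊢
    rw [hℓ]
    simp only [mem_Ioc, not_and_or, not_lt, not_le]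
    constructor
    · intro _; left; linarith
    · intro _; left; linarith

theorem compl_extremitySet_ae_eq {α : ℝ} (hα : 4 ≤ α) :
    ((extremitySet Star611 α)ᶜ : Set Star611) =ᵐ[length Star611] middlePart α := by
  rw [Filter.eventuallyEq_set]
  filter_upwards [ae_mem_extremitySet_iff hα] with x hx
  rw [mem_compl_iff, hx, not_not]

theorem length_middlePart_inter {α : ℝ} (hα : 4 ≤ α) (s : Set ℝ) :
    length Star611 {x | x.1 0 ∈ Ioc (α / 2 - 2) (6 - α / 2) ∩ s} =
      volume (Ioc (α / 2 - 2) (6 - α / 2) ∩ s) := by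
  apply length_setOf_coord_mem
  rintro t ⟨ht, -⟩
  refine ⟨by linarith [ht.1], ht.2.trans ?_⟩
  simp
  linarith

theorem length_middlePart {α : ℝ} (hα : 4 ≤ α) :
    length Star611 (middlePart α) = ENNReal.ofReal (8 - α) := by
  have := length_middlePart_inter hα univ
  rw [inter_univ, Real.volume_Ioc] at this
  rw [middlePart, this]
  congr 1; ring

theorem length_compl_extremitySet {α : ℝ} (hα : 4 ≤ α) :
    length Star611 (extremitySet Star611 α)ᶜ = ENNReal.ofReal (8 - α) := by
  rw [measure_congr (compl_extremitySet_ae_eq hα), length_middlePart hα]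

theorem length_extremitySet {α : ℝ} (hα : 4 ≤ α) (hα' : α ≤ 8) :
    length Star611 (extremitySet Star611 α) = ENNReal.ofReal α := by
  have h : extremitySet Star611 α =ᵐ[length Star611] ((middlePart α)ᶜ : Set Star611) :=
    ae_eq_set_compl.1 (compl_extremitySet_ae_eq hα)
  rw [measure_congr h, measure_compl (measurableSet_middlePart α)
    (length_middlePart hα ▸ ENNReal.ofReal_ne_top), length_middlePart hα]
  change totalLength Star611 - _ = _
  rw [totalLength_star611, show (8 : ℝ≥0∞) = ENNReal.ofReal 8 by simp,
    ← ENNReal.ofReal_sub _ (by linarith)]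
  congr 1; ring

theorem vStar_star611 {α : ℝ} (hα : 4 ≤ α) (hα' : α ≤ 8) :
    vStar Star611 α = ENNReal.ofReal (α / (8 + α)) := by
  rw [vStar, totalLength_star611, length_extremitySet hα hα',
    show (8 : ℝ≥0∞) = ENNReal.ofReal 8 by simp, ← ENNReal.ofReal_add (by norm_num) (by linarith),
    ENNReal.ofReal_div_of_pos (by linarith)]

theorem theta_eq {α : ℝ} (hα : 4 ≤ α) (hα' : α ≤ 8) :
    theta α = ENNReal.ofReal (2 * (8 + α)) := by
  rw [theta, totalLength_star611, length_extremitySet hα hα',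
    show (8 : ℝ≥0∞) = ENNReal.ofReal 8 by simp, ← ENNReal.ofReal_add (by norm_num) (by linarith),
    ENNReal.ofReal_mul (by norm_num)]
  simp

/-! ## Measurability of the interception event -/

section Game

variable {X : Type} [MetricSpace X]

/-- By continuity and compactness, the point is met in the interval exactly when the distances to it
at countably many dense times come arbitrarily close to `0`. This makes the event a countable
combination of measurable ones. -/
theorem intercepts_iff_forall_exists_dist_lt {α : ℝ} (hα : 0 ≤ α) (S : Patrol X) (a : Attack X) :
    Intercepts α S a ↔ ∀ n : ℕ, ∃ m : ℕ,
      dist (S.1 (a.2 + min (TopologicalSpace.denseSeq ℝ≥0 m) α.toNNReal)) a.1 < 1 / (n + 1 : ℝ) := by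
  set g : ℝ≥0 → ℝ := fun q => dist (S.1 (a.2 + min q α.toNNReal)) a.1 with hg
  have hgc : Continuous g :=
    (S.2.continuous.comp (by fun_prop)).dist continuous_const
  constructor
  · rintro ⟨t, ht1, ht2, ht⟩ n
    have hopen : IsOpen {q | g q < 1 / (n + 1 : ℝ)} := isOpen_lt hgc continuous_const
    obtain ⟨q, hq, m, rfl⟩ := (TopologicalSpace.denseRange_denseSeq ℝ≥0).inter_open_nonempty _
      hopen ⟨t - a.2, by
        have h1 : t - a.2 ≤ α.toNNReal := by
          rw [tsub_le_iff_left, ← NNReal.coe_le_coe, NNReal.coe_add, Real.coe_toNNReal _ hα]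
          exact ht2
        change dist _ _ < _
        rw [min_eq_left h1, add_tsub_cancel_of_le ht1, ht, dist_self]
        positivity⟩
    exact ⟨m, hq⟩
  · intro h
    obtain ⟨q, hq, hmin⟩ := (isCompact_Icc (a := (0 : ℝ≥0)) (b := α.toNNReal)).exists_isMinOn
      (nonempty_Icc.2 zero_le) hgc.continuousOn
    have hq0 : g q ≤ 0 := by
      refine le_of_forall_pos_lt_add fun ε hε => ?_
      obtain ⟨n, hn⟩ := exists_nat_one_div_lt hε
      obtain ⟨m, hm⟩ := h n
      have h1 : g q ≤ g (min (TopologicalSpace.denseSeq ℝ≥0 m) α.toNNReal) :=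
        hmin ⟨zero_le, min_le_right _ _⟩
      have h2 : g (min (TopologicalSpace.denseSeq ℝ≥0 m) α.toNNReal) =
          g (TopologicalSpace.denseSeq ℝ≥0 m) := by
        simp [hg]
      linarith
    refine ⟨a.2 + min q α.toNNReal, le_self_add, ?_, dist_le_zero.1 hq0⟩
    rw [NNReal.coe_add]
    have : ((min q α.toNNReal : ℝ≥0) : ℝ) ≤ (α.toNNReal : ℝ) := by
      exact_mod_cast min_le_right _ _
    rw [Real.coe_toNNReal _ hα] at this
    linarith

variable [MeasurableSpace X] [BorelSpace X] [SecondCountableTopology X]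

theorem measurableSet_intercepts {α : ℝ} (hα : 0 ≤ α) :
    MeasurableSet {q : Patrol X × Attack X | Intercepts α q.1 q.2} := by
  have heval : Measurable (Function.uncurry fun (t : ℝ≥0) (S : Patrol X) => S.1 t) :=
    measurable_uncurry_of_continuous_of_measurable (fun S => S.2.continuous)
      fun t => (measurable_pi_apply t).comp measurable_subtype_coe
  have hset : {q : Patrol X × Attack X | Intercepts α q.1 q.2} = ⋂ n : ℕ, ⋃ m : ℕ,
      {q | dist (q.1.1 (q.2.2 + min (TopologicalSpace.denseSeq ℝ≥0 m) α.toNNReal)) q.2.1 <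
        1 / (n + 1 : ℝ)} := by
    ext q
    simp [intercepts_iff_forall_exists_dist_lt hα]
  rw [hset]
  refine MeasurableSet.iInter fun n => MeasurableSet.iUnion fun m => ?_
  refine measurableSet_lt (Measurable.dist ?_ (by fun_prop)) measurable_const
  have : Measurable fun q : Patrol X × Attack X =>
      ((q.2.2 + min (TopologicalSpace.denseSeq ℝ≥0 m) α.toNNReal, q.1) : ℝ≥0 × Patrol X) := by
    fun_prop
  exact heval.comp this

theorem measurableSet_intercepts_patrol {α : ℝ} (hα : 0 ≤ α) (S : Patrol X) :
    MeasurableSet {a | Intercepts α S a} :=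
  measurable_prodMk_left (measurableSet_intercepts hα)

theorem interceptProb_eq_lintegral_patrol {α : ℝ} (hα : 0 ≤ α) (P : Measure (Patrol X))
    (A : Measure (Attack X)) [SFinite A] :
    interceptProb α P A = ∫⁻ S, A {a | Intercepts α S a} ∂P :=
  Measure.prod_apply (measurableSet_intercepts hα)

theorem interceptProb_eq_lintegral_attack {α : ℝ} (hα : 0 ≤ α) (P : Measure (Patrol X)) [SFinite P]
    (A : Measure (Attack X)) [SFinite A] :
    interceptProb α P A = ∫⁻ a, P {S | Intercepts α S a} ∂A :=
  Measure.prod_apply_symm (measurableSet_intercepts hα)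

theorem interceptProb_le_of_forall_patrol {α : ℝ} (hα : 0 ≤ α) {v : ℝ≥0∞}
    (A : Measure (Attack X)) [SFinite A] (h : ∀ S, A {a | Intercepts α S a} ≤ v)
    (P : Measure (Patrol X)) [IsProbabilityMeasure P] : interceptProb α P A ≤ v := by
  rw [interceptProb_eq_lintegral_patrol hα]
  exact (lintegral_mono h).trans_eq (by simp)

theorem le_interceptProb_of_forall_attack {α : ℝ} (hα : 0 ≤ α) {v : ℝ≥0∞}
    (P : Measure (Patrol X)) [SFinite P] (h : ∀ a, v ≤ P {S | Intercepts α S a})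
    (A : Measure (Attack X)) [IsProbabilityMeasure A] : v ≤ interceptProb α P A := by
  rw [interceptProb_eq_lintegral_attack hα]
  exact (by simp : v = ∫⁻ _, v ∂A).le.trans (lintegral_mono h)

/-- A mixed patrol and a mixed attack that guarantee the same probability against all pure
strategies determine the value of the game. -/
theorem hasValue_of_saddle {α : ℝ} (hα : 0 ≤ α) {v : ℝ≥0∞}
    (P : Measure (Patrol X)) [IsProbabilityMeasure P] (hP : ∀ a, v ≤ P {S | Intercepts α S a})
    (A : Measure (Attack X)) [IsProbabilityMeasure A] (hA : ∀ S, A {a | Intercepts α S a} ≤ v) :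
    HasValue X α v := by
  have hlow : v ≤ ⨆ P : ProbabilityMeasure (Patrol X), ⨅ A : ProbabilityMeasure (Attack X),
      interceptProb α (P : Measure (Patrol X)) (A : Measure (Attack X)) :=
    le_iSup_of_le (⟨P, inferInstance⟩ : ProbabilityMeasure (Patrol X))
      (le_iInf fun A => le_interceptProb_of_forall_attack hα P hP A)
  have hup : (⨅ A : ProbabilityMeasure (Attack X), ⨆ P : ProbabilityMeasure (Patrol X),
      interceptProb α (P : Measure (Patrol X)) (A : Measure (Attack X))) ≤ v :=
    iInf_le_of_le (⟨A, inferInstance⟩ : ProbabilityMeasure (Attack X))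
      (iSup_le fun P => interceptProb_le_of_forall_patrol hα A hA P)
  have hmid := iSup_iInf_le_iInf_iSup fun (P : ProbabilityMeasure (Patrol X))
    (A : ProbabilityMeasure (Attack X)) =>
      interceptProb α (P : Measure (Patrol X)) (A : Measure (Attack X))
  exact ⟨le_antisymm (hmid.trans hup) hlow, le_antisymm hup (hlow.trans hmid)⟩

theorem iSup_interceptProb_of_saddle {α : ℝ} (hα : 0 ≤ α) {v : ℝ≥0∞}
    (P : Measure (Patrol X)) [IsProbabilityMeasure P] (hP : ∀ a, v ≤ P {S | Intercepts α S a})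
    (A : Measure (Attack X)) [IsProbabilityMeasure A] (hA : ∀ S, A {a | Intercepts α S a} ≤ v) :
    (⨆ P : ProbabilityMeasure (Patrol X), interceptProb α (P : Measure (Patrol X)) A) = v :=
  le_antisymm (iSup_le fun P => interceptProb_le_of_forall_patrol hα A hA P)
    (le_iSup_of_le (⟨P, inferInstance⟩ : ProbabilityMeasure (Patrol X))
      (le_interceptProb_of_forall_attack hα P hP A))

theorem isGreatest_of_saddle {α : ℝ} (hα : 0 ≤ α) {v : ℝ≥0∞}
    (P : Measure (Patrol X)) [IsProbabilityMeasure P] (hP : ∀ a, v ≤ P {S | Intercepts α S a})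
    (A : Measure (Attack X)) [IsProbabilityMeasure A] (hA : ∀ S, A {a | Intercepts α S a} ≤ v) :
    IsGreatest (range fun S : Patrol X => A {a | Intercepts α S a}) v := by
  have h : v ≤ ∫⁻ S, A {a | Intercepts α S a} ∂P := by
    rw [← interceptProb_eq_lintegral_patrol hα]
    exact le_interceptProb_of_forall_attack hα P hP A
  have hfin : ∫⁻ S, A {a | Intercepts α S a} ∂P ≠ ∞ :=
    ((lintegral_mono fun S => prob_le_one).trans_lt (by simp : ∫⁻ _, (1 : ℝ≥0∞) ∂P < ∞)).ne
  -- The average over `P` is at least `v` and no patrol exceeds `v`, so a patrol that reaches the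
  -- average attains `v`.
  obtain ⟨S, hS⟩ := exists_lintegral_le hfin
  exact ⟨⟨S, le_antisymm (hA S) (h.trans hS)⟩, by rintro _ ⟨S, rfl⟩; exact hA S⟩

end Game

/-! ## The interception probability of the 6-1-1-attack -/

theorem eq_node9_iff (x : Star611) : x = node9 ↔ x.1 0 = 6 := by
  have h : (node9 : Star611).1 0 = 6 := by simp [node9, leafNode]
  constructor
  · rintro rfl
    exact h
  · intro hx
    exact Star.eq_of_coord_eq (i := 0) (by rw [hx]; norm_num) (hx.trans h.symm)

theorem coord_le_of_dist_shortNode {i : Fin 3} (hi : i ≠ 0) (x : Star611) :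
    x.1 0 ≤ max 0 (dist x (leafNode ![6, 1, 1] i) - 1) := by
  rcases (x.coord_mem 0).1.lt_or_eq with h | h
  · refine le_max_of_le_right ?_
    have hℓ : ((![6, 1, 1] : Fin 3 → ℝ≥0) i : ℝ) = 1 := by
      fin_cases i <;> simp at hi ⊢
    have h1 : ((![6, 1, 1] : Fin 3 → ℝ≥0) i : ℝ) ∈ Icc 0 ((![6, 1, 1] : Fin 3 → ℝ≥0) i : ℝ) :=
      ⟨by rw [hℓ]; norm_num, le_rfl⟩
    rw [Star.eq_arcPoint_of_pos h, leafNode_eq_arcPoint,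
      dist_arcPoint_of_ne hi.symm (x.coord_mem 0) h1, arcPoint_coord (x.coord_mem 0), hℓ]
    simp
  · rw [← h]
    exact le_max_left _ _

/-- A patrol as a path on the real line, with the time `α + 1` moved to `0`. -/
def centeredPath (α : ℝ) (S : Patrol Star611) (s : ℝ) : Star611 :=
  S.1 (s + (α + 1)).toNNReal

/-- Before the original time `0` the path is extended as a constant, and clipping times at `0` does
not increase distances. The extension can only add visits, which is harmless for an upper bound. -/
theorem dist_centeredPath_le (α : ℝ) (S : Patrol Star611) (s t : ℝ) :
    dist (centeredPath α S s) (centeredPath α S t) ≤ |s - t| := by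
  have h := S.2.dist_le_mul (s + (α + 1)).toNNReal (t + (α + 1)).toNNReal
  rw [NNReal.coe_one, one_mul, NNReal.dist_eq, Real.coe_toNNReal', Real.coe_toNNReal'] at h
  refine h.trans ((abs_max_sub_max_le_max _ _ _ _).trans ?_)
  rw [sub_self, abs_zero, max_eq_left (abs_nonneg _), add_sub_add_right_eq_sub]

theorem continuous_centeredPath (α : ℝ) (S : Patrol Star611) : Continuous (centeredPath α S) :=
  (LipschitzWith.of_dist_le_mul (K := 1) fun s t => by
    simpa [Real.dist_eq] using dist_centeredPath_le α S s t).continuous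

theorem centeredPath_sub (α : ℝ) (S : Patrol Star611) (t : ℝ≥0) :
    centeredPath α S (t - (α + 1)) = S.1 t := by
  rw [centeredPath, sub_add_cancel, Real.toNNReal_coe]

theorem pathData_centeredPath (α : ℝ) (S : Patrol Star611) :
    PathData (fun s => (centeredPath α S s).1 0) {s | centeredPath α S s = node1}
      {s | centeredPath α S s = node2} where
  lipschitz s t := (Star.abs_coord_sub_le _ _ 0).trans (dist_centeredPath_le α S s t)
  closed₁ := isClosed_eq (continuous_centeredPath α S) continuous_const
  closed₂ := isClosed_eq (continuous_centeredPath α S) continuous_const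
  separated v hv v' hv' := by
    have h := dist_centeredPath_le α S v v'
    rw [mem_ofPred_eq] at hv hv'
    rw [hv, hv', node1, node2, dist_leafNode (by decide)] at h
    have e1 : ((![6, 1, 1] : Fin 3 → ℝ≥0) 1 : ℝ) = 1 := by simp
    have e2 : ((![6, 1, 1] : Fin 3 → ℝ≥0) 2 : ℝ) = 1 := by simp
    rw [e1, e2] at h
    linarith
  near v hv t := by
    have h := dist_centeredPath_le α S t v
    rcases hv with hv | hv <;> rw [mem_ofPred_eq] at hv 
    · rw [hv, node1] at h
      exact (coord_le_of_dist_shortNode (i := 1) (by decide) _).trans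
        (max_le_max le_rfl (by linarith [h]))
    · rw [hv, node2] at h
      exact (coord_le_of_dist_shortNode (i := 2) (by decide) _).trans
        (max_le_max le_rfl (by linarith [h]))

theorem volume_starts_le (α : ℝ) (S : Patrol Star611) (x : Star611) {c : ℝ} (hc : 0 ≤ c + 1) :
    volume (Icc (c + 1) (c + 1 + α) ∩ Real.toNNReal ⁻¹' {τ | Intercepts α S (x, τ)}) ≤
      volume (interceptedStarts {s | centeredPath α S s = x} c α) := by
  rw [← measure_preimage_add_right volume (-(α + 1)) (interceptedStarts _ c α)]
  refine measure_mono ?_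
  rintro τ ⟨⟨h1, h2⟩, t, ht1, ht2, ht⟩
  have h0 : 0 ≤ τ := hc.trans h1
  change τ.toNNReal ≤ t at ht1
  change (t : ℝ) ≤ (τ.toNNReal : ℝ) + α at ht2
  rw [Real.toNNReal_le_iff_le_coe] at ht1
  rw [Real.coe_toNNReal _ h0] at ht2
  refine ⟨⟨by linarith, by linarith⟩, (t : ℝ) - (α + 1), ?_, by linarith, by linarith⟩
  change centeredPath α S _ = x
  rw [centeredPath_sub]
  exact ht

theorem length_middle_le {α : ℝ} (hα : 4 ≤ α) (S : Patrol Star611) {c : ℝ} (hc : 0 ≤ c + 1) :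
    length Star611 (middlePart α ∩ {x | Intercepts α S (x, (α / 2 + (c + 1)).toNNReal)}) ≤
      volume (visitedMiddle (fun s => (centeredPath α S s).1 0) (α / 2) c) := by
  refine (measure_mono ?_).trans ((length_middlePart_inter hα
    (visitedMiddle (fun s => (centeredPath α S s).1 0) (α / 2) c)).trans_le
      (measure_mono inter_subset_right))
  rintro x ⟨hx, t, ht1, ht2, ht⟩
  refine ⟨hx, ⟨Ioc_subset_Icc_self hx, (t : ℝ) - (α + 1), ?_, ?_⟩⟩
  · change (α / 2 + (c + 1)).toNNReal ≤ t at ht1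
    change (t : ℝ) ≤ ((α / 2 + (c + 1)).toNNReal : ℝ) + α at ht2
    rw [Real.toNNReal_le_iff_le_coe] at ht1
    rw [Real.coe_toNNReal _ (by linarith)] at ht2
    constructor <;> linarith
  · change (centeredPath α S _).1 0 = x.1 0
    rw [centeredPath_sub, ht]

/-- The pure patrol version of the upper bound, before normalization. -/
theorem total_le_of_patrol {α : ℝ} (hα : 4 ≤ α) (hα' : α ≤ 8) (S : Patrol Star611) :
    volume (Icc 1 (1 + α) ∩ Real.toNNReal ⁻¹' {τ | Intercepts α S (node1, τ)}) +
      volume (Icc 1 (1 + α) ∩ Real.toNNReal ⁻¹' {τ | Intercepts α S (node2, τ)}) +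
      volume (Icc 0 α ∩ Real.toNNReal ⁻¹' {τ | Intercepts α S (node9, τ)}) +
      volume (Icc 2 (α + 2) ∩ Real.toNNReal ⁻¹' {τ | Intercepts α S (node9, τ)}) +
      length Star611 (middlePart α ∩ {x | Intercepts α S (x, (α / 2).toNNReal)}) +
      length Star611 (middlePart α ∩ {x | Intercepts α S (x, (α / 2 + 2).toNNReal)}) ≤
    ENNReal.ofReal (2 * α) := by
  have h1 := volume_starts_le α S node1 (c := 0) (by norm_num)
  have h2 := volume_starts_le α S node2 (c := 0) (by norm_num)
  have h3 := volume_starts_le α S node9 (c := -1) (by norm_num)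
  have h4 := volume_starts_le α S node9 (c := 1) (by norm_num)
  have h5 := length_middle_le hα S (c := -1) (by norm_num)
  have h6 := length_middle_le hα S (c := 1) (by norm_num)
  simp only [eq_node9_iff] at h3 h4
  rw [zero_add] at h1 h2
  rw [neg_add_cancel, zero_add] at h3
  rw [neg_add_cancel, add_zero] at h5
  rw [show (1 : ℝ) + 1 = 2 by norm_num] at h4 h6
  rw [add_comm 2 α] at h4
  have key := (pathData_centeredPath α S).total_le (r := α / 2) (by linarith) (by linarith)
  rw [mul_div_cancel₀ α two_ne_zero] at key
  have fin := volume_interceptedStarts_ne_top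
  have fin' := volume_visitedMiddle_ne_top (fun s => (centeredPath α S s).1 0) (α / 2)
  refine (add_le_add (add_le_add (add_le_add (add_le_add (add_le_add h1 h2) h3) h4) h5) h6).trans ?_
  rw [ENNReal.le_ofReal_iff_toReal_le (by simp [fin, fin']) (by linarith),
    ENNReal.toReal_add (by simp [fin, fin']) (fin' _),
    ENNReal.toReal_add (by simp [fin]) (fin' _), ENNReal.toReal_add (by simp [fin]) (fin _ _ _),
    ENNReal.toReal_add (by simp [fin]) (fin _ _ _), ENNReal.toReal_add (fin _ _ _) (fin _ _ _)]
  linarith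

/-! ### Evaluating the components of the attack -/

theorem uniformTime_apply {a b : ℝ} (hab : a < b) {T : Set ℝ≥0} (hT : MeasurableSet T) :
    uniformTime a b T =
      ENNReal.ofReal (1 / (b - a)) * volume (Icc a b ∩ Real.toNNReal ⁻¹' T) := by
  rw [uniformTime, Measure.map_apply measurable_real_toNNReal hT,
    cond_apply measurableSet_Icc, Real.volume_Icc, one_div, ENNReal.ofReal_inv_of_pos (by linarith)]

theorem isProbabilityMeasure_uniformTime {a b : ℝ} (hab : a < b) :
    IsProbabilityMeasure (uniformTime a b) := by
  constructor
  rw [uniformTime_apply hab MeasurableSet.univ, preimage_univ, inter_univ, Real.volume_Icc,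
    ← ENNReal.ofReal_mul (by rw [one_div]; exact inv_nonneg.2 (by linarith)),
    one_div_mul_cancel (by linarith), ENNReal.ofReal_one]

instance (a b : ℝ) : SFinite (uniformTime a b) := by
  unfold uniformTime
  infer_instance

instance (α : ℝ) : SFinite (rightStart α) := by
  unfold rightStart
  infer_instance

instance (α : ℝ) : SFinite (leftAttack α) := by
  unfold leftAttack
  infer_instance

instance (α : ℝ) : SFinite (middleAttack α) := by
  unfold middleAttack
  infer_instance

instance (α : ℝ) : SFinite (rightAttack α) := by
  unfold rightAttack
  infer_instance

instance (α : ℝ) : SFinite (attack611 α) := by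
  unfold attack611
  infer_instance

instance : IsFiniteMeasure (length Star611) :=
  ⟨by
    change totalLength Star611 < ∞
    rw [totalLength_star611]
    simp⟩

theorem leftAttack_apply (α : ℝ) {D : Set (Attack Star611)} (hD : MeasurableSet D) :
    leftAttack α D = (1 / 2) * uniformTime 1 (1 + α) {τ | (node1, τ) ∈ D} +
      (1 / 2) * uniformTime 1 (1 + α) {τ | (node2, τ) ∈ D} := by
  rw [leftAttack, Measure.prod_apply hD, lintegral_add_measure, lintegral_smul_measure,
    lintegral_smul_measure, lintegral_dirac, lintegral_dirac]
  rfl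

theorem rightAttack_apply (α : ℝ) {D : Set (Attack Star611)} (hD : MeasurableSet D) :
    rightAttack α D = ENNReal.ofReal (1 / α) * uniformTime 0 2 {τ | (node9, τ) ∈ D} +
      ENNReal.ofReal ((α - 2) / α) * uniformTime 2 α {τ | (node9, τ) ∈ D} +
      ENNReal.ofReal (1 / α) * uniformTime α (α + 2) {τ | (node9, τ) ∈ D} := by
  rw [rightAttack, Measure.prod_apply hD, lintegral_dirac]
  rfl

theorem cond_compl_extremitySet_apply {α : ℝ} (hα : 4 ≤ α) {s : Set Star611}
    (hs : MeasurableSet s) :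
    ProbabilityTheory.cond (length Star611) (extremitySet Star611 α)ᶜ s =
      (ENNReal.ofReal (8 - α))⁻¹ * length Star611 (middlePart α ∩ s) := by
  rw [ProbabilityTheory.cond, length_compl_extremitySet hα,
    Measure.restrict_congr_set (compl_extremitySet_ae_eq hα), Measure.smul_apply,
    Measure.restrict_apply hs, inter_comm, smul_eq_mul]

theorem middleAttack_apply {α : ℝ} (hα : 4 ≤ α) {D : Set (Attack Star611)} (hD : MeasurableSet D) :
    middleAttack α D = (ENNReal.ofReal (8 - α))⁻¹ * ((1 / 2) *
        length Star611 (middlePart α ∩ {x | (x, (α / 2).toNNReal) ∈ D}) +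
      (1 / 2) * length Star611 (middlePart α ∩ {x | (x, (α / 2 + 2).toNNReal) ∈ D})) := by
  have h : ∀ τ, ProbabilityTheory.cond (length Star611) (extremitySet Star611 α)ᶜ
      ((fun x => (x, τ)) ⁻¹' D) =
      (ENNReal.ofReal (8 - α))⁻¹ * length Star611 (middlePart α ∩ {x | (x, τ) ∈ D}) := fun τ =>
    cond_compl_extremitySet_apply hα (measurable_prodMk_right hD)
  rw [middleAttack, Measure.prod_apply_symm hD, lintegral_add_measure, lintegral_smul_measure,
    lintegral_smul_measure, lintegral_dirac, lintegral_dirac, h, h, smul_eq_mul, smul_eq_mul]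
  ring

theorem volume_Icc_add_le (a b c : ℝ) (T : Set ℝ) (hab : a ≤ b) (hbc : b ≤ c)
    (hT : MeasurableSet T) :
    volume (Icc a b ∩ T) + volume (Icc b c ∩ T) ≤ volume (Icc a c ∩ T) := by
  have h : AEDisjoint volume (Icc a b ∩ T) (Icc b c ∩ T) := by
    refine measure_mono_null (fun x hx => ?_) (Real.volume_singleton (a := b))
    exact le_antisymm hx.1.1.2 hx.2.1.1
  rw [← measure_union₀ (measurableSet_Icc.inter hT).nullMeasurableSet h, ← union_inter_distrib_right,
    Icc_union_Icc_eq_Icc hab hbc]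

theorem two_mul_ofReal_div_theta {α : ℝ} (hα : 4 ≤ α) (hα' : α ≤ 8) (a : ℝ) :
    2 * ENNReal.ofReal a / theta α = ENNReal.ofReal (a / (8 + α)) := by
  rw [theta_eq hα hα', show (2 : ℝ≥0∞) = ENNReal.ofReal 2 by simp,
    ← ENNReal.ofReal_mul two_pos.le, ← ENNReal.ofReal_div_of_pos (by linarith),
    mul_div_mul_left _ _ two_ne_zero]

theorem attack611_intercepts_le {α : ℝ} (hα : 4 ≤ α) (hα' : α ≤ 8) (S : Patrol Star611) :
    attack611 α {a | Intercepts α S a} ≤ vStar Star611 α := by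
  have hα0 : 0 ≤ α := by linarith
  have hD := measurableSet_intercepts_patrol hα0 S
  have hsec : ∀ x, MeasurableSet {τ | (x, τ) ∈ {a | Intercepts α S a}} := fun x =>
    measurable_prodMk_left hD
  have hT : MeasurableSet (Real.toNNReal ⁻¹' {τ | (node9, τ) ∈ {a | Intercepts α S a}}) :=
    measurable_real_toNNReal (hsec node9)
  -- The common weight `1 / θ` of all six length terms.
  set κ : ℝ≥0∞ := ENNReal.ofReal (1 / (2 * (8 + α))) with hκ
  have half : (1 / 2 : ℝ≥0∞) = ENNReal.ofReal (1 / 2) := by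
    rw [ENNReal.ofReal_div_of_pos two_pos]
    simp
  have hw : 2 * ENNReal.ofReal α / theta α = ENNReal.ofReal (α / (8 + α)) :=
    two_mul_ofReal_div_theta hα hα' α
  have hleft : 2 * ENNReal.ofReal α / theta α * leftAttack α {a | Intercepts α S a} =
      κ * volume (Icc 1 (1 + α) ∩ Real.toNNReal ⁻¹' {τ | Intercepts α S (node1, τ)}) +
      κ * volume (Icc 1 (1 + α) ∩ Real.toNNReal ⁻¹' {τ | Intercepts α S (node2, τ)}) := by
    have hc : ENNReal.ofReal (α / (8 + α)) *
        (ENNReal.ofReal (1 / 2) * ENNReal.ofReal (1 / (1 + α - 1))) = κ := by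
      rw [← ENNReal.ofReal_mul (by norm_num), ← ENNReal.ofReal_mul (by positivity), hκ]
      congr 1
      rw [add_sub_cancel_left]
      field_simp
    rw [leftAttack_apply α hD, uniformTime_apply (by linarith) (hsec _),
      uniformTime_apply (by linarith) (hsec _), half, hw, ← hc]
    simp only [mul_add, mul_assoc]
    rfl
  have hright : 2 * ENNReal.ofReal α / theta α * rightAttack α {a | Intercepts α S a} ≤
      κ * volume (Icc 0 α ∩ Real.toNNReal ⁻¹' {τ | Intercepts α S (node9, τ)}) +
      κ * volume (Icc 2 (α + 2) ∩ Real.toNNReal ⁻¹' {τ | Intercepts α S (node9, τ)}) := by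
    have hc : ENNReal.ofReal (α / (8 + α)) *
        (ENNReal.ofReal (1 / α) * ENNReal.ofReal (1 / (2 - 0))) = κ := by
      rw [← ENNReal.ofReal_mul (by positivity), ← ENNReal.ofReal_mul (by positivity), hκ]
      congr 1
      field_simp
      norm_num
    have hc' : ENNReal.ofReal (α / (8 + α)) *
        (ENNReal.ofReal (1 / α) * ENNReal.ofReal (1 / (α + 2 - α))) = κ := by
      rw [← hc]
      congr 4
      ring
    -- On `[2, α]` the density is doubled, because this interval belongs to both `[0, α]` and `[2, α
    -- + 2]`.
    have hc2 : ENNReal.ofReal (α / (8 + α)) *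
        (ENNReal.ofReal ((α - 2) / α) * ENNReal.ofReal (1 / (α - 2))) = κ + κ := by
      have h2 : 0 < α - 2 := by linarith
      rw [← ENNReal.ofReal_mul (by positivity), ← ENNReal.ofReal_mul (by positivity), hκ,
        ← ENNReal.ofReal_add (by positivity) (by positivity)]
      congr 1
      field_simp
      norm_num
    rw [rightAttack_apply α hD, uniformTime_apply (by linarith) (hsec _),
      uniformTime_apply (by linarith) (hsec _), uniformTime_apply (by linarith) (hsec _), hw]
    simp only [mul_add, ← mul_assoc] at hc hc' hc2 ⊢
    rw [hc, hc', hc2]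
    have e1 := volume_Icc_add_le 0 2 α _ (by linarith) (by linarith) hT
    have e2 := volume_Icc_add_le 2 α (α + 2) _ (by linarith) (by linarith) hT
    refine le_trans (le_of_eq ?_) (add_le_add (mul_le_mul_right e1 κ) (mul_le_mul_right e2 κ))
    ring
  have hmiddle : 2 * length Star611 (extremitySet Star611 α)ᶜ / theta α *
      middleAttack α {a | Intercepts α S a} ≤
      κ * length Star611 (middlePart α ∩ {x | Intercepts α S (x, (α / 2).toNNReal)}) +
      κ * length Star611 (middlePart α ∩ {x | Intercepts α S (x, (α / 2 + 2).toNNReal)}) := by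
    have hc : 2 * (1 / 2) * (theta α)⁻¹ = κ := by
      rw [one_div, ENNReal.mul_inv_cancel two_ne_zero (by simp), one_mul, theta_eq hα hα', hκ,
        one_div, ENNReal.ofReal_inv_of_pos (by linarith)]
    rw [middleAttack_apply hα hD, length_compl_extremitySet hα, div_eq_mul_inv]
    calc _ = ENNReal.ofReal (8 - α) * (ENNReal.ofReal (8 - α))⁻¹ * (2 * (1 / 2) * (theta α)⁻¹ *
          length Star611 (middlePart α ∩ {x | Intercepts α S (x, (α / 2).toNNReal)}) +
          2 * (1 / 2) * (theta α)⁻¹ *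
          length Star611 (middlePart α ∩ {x | Intercepts α S (x, (α / 2 + 2).toNNReal)})) := by
          simp only [mem_ofPred_eq]
          ring
      -- Only an inequality, since for `α = 8` the product of `8 - α` with its inverse is `0`.
      _ ≤ 1 * _ := mul_le_mul_left (ENNReal.mul_inv_le_one _) _
      _ = _ := by rw [hc, one_mul]
  have htot := mul_le_mul_right (total_le_of_patrol hα hα' S) κ
  have hκα : κ * ENNReal.ofReal (2 * α) = vStar Star611 α := by
    rw [vStar_star611 hα hα', hκ, ← ENNReal.ofReal_mul (by positivity)]
    congr 1
    field_simp
  rw [attack611]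
  simp only [Measure.add_apply, Measure.smul_apply, smul_eq_mul]
  refine (add_le_add (add_le_add hleft.le hmiddle) hright).trans ?_
  rw [← hκα]
  refine le_trans (le_of_eq ?_) htot
  ring

theorem isProbabilityMeasure_attack611 {α : ℝ} (hα : 4 ≤ α) (hα' : α ≤ 8) :
    IsProbabilityMeasure (attack611 α) := by
  have half : (1 / 2 : ℝ≥0∞) + 1 / 2 = 1 := by
    rw [one_div]
    exact ENNReal.inv_two_add_inv_two
  have hleft : leftAttack α univ = 1 := by
    have := isProbabilityMeasure_uniformTime (a := 1) (b := 1 + α) (by linarith)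
    rw [leftAttack_apply α MeasurableSet.univ]
    simp only [mem_univ, ofPred_true, measure_univ, mul_one]
    exact half
  have hright : rightAttack α univ = 1 := by
    have := isProbabilityMeasure_uniformTime (a := 0) (b := 2) (by norm_num)
    have := isProbabilityMeasure_uniformTime (a := 2) (b := α) (by linarith)
    have := isProbabilityMeasure_uniformTime (a := α) (b := α + 2) (by linarith)
    have h2 : 0 ≤ α - 2 := by linarith
    rw [rightAttack_apply α MeasurableSet.univ]
    simp only [mem_univ, ofPred_true, measure_univ, mul_one]
    rw [← ENNReal.ofReal_add (by positivity) (by positivity),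
      ← ENNReal.ofReal_add (by positivity) (by positivity), ENNReal.ofReal_eq_one]
    field_simp
    ring
  have hmiddle : ENNReal.ofReal (8 - α) * middleAttack α univ = ENNReal.ofReal (8 - α) := by
    rw [middleAttack_apply hα MeasurableSet.univ]
    simp only [mem_univ, ofPred_true, inter_univ]
    rw [length_middlePart hα, ← add_mul, half, one_mul]
    rcases eq_or_ne (ENNReal.ofReal (8 - α)) 0 with h | h
    · rw [h, zero_mul]
    · rw [ENNReal.inv_mul_cancel h ENNReal.ofReal_ne_top, mul_one]
  have h8 : 0 ≤ 8 - α := by linarith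
  have hmid : 2 * ENNReal.ofReal (8 - α) / theta α * middleAttack α univ =
      ENNReal.ofReal ((8 - α) / (8 + α)) := by
    rw [← two_mul_ofReal_div_theta hα hα', div_eq_mul_inv, mul_right_comm, mul_assoc 2, hmiddle]
  constructor
  rw [attack611]
  simp only [Measure.add_apply, Measure.smul_apply, smul_eq_mul]
  rw [hleft, hright, length_compl_extremitySet hα, hmid, mul_one,
    two_mul_ofReal_div_theta hα hα', ← ENNReal.ofReal_add (by positivity) (by positivity),
    ← ENNReal.ofReal_add (by positivity) (by positivity), ENNReal.ofReal_eq_one]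
  field_simp
  ring

/-! ## Optimal patrols -/

section Periodize

variable {X : Type} {e : ℝ → X} {ρ : ℝ}

/-- The function of period `2 * ρ` that agrees with `e` on `[-ρ, ρ)`. -/
def periodize (e : ℝ → X) (ρ t : ℝ) : X :=
  e (2 * ρ * Int.fract ((t + ρ) / (2 * ρ)) - ρ)

theorem exists_periodize_eq (hρ : 0 < ρ) (e : ℝ → X) (t : ℝ) :
    ∃ n : ℤ, t - 2 * ρ * n ∈ Ico (-ρ) ρ ∧ periodize e ρ t = e (t - 2 * ρ * n) := by
  have h : 2 * ρ * Int.fract ((t + ρ) / (2 * ρ)) - ρ = t - 2 * ρ * ⌊(t + ρ) / (2 * ρ)⌋ := by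
    rw [← Int.self_sub_floor]
    field_simp
    ring
  refine ⟨⌊(t + ρ) / (2 * ρ)⌋, ?_, ?_⟩
  · rw [← h]
    have h0 := Int.fract_nonneg ((t + ρ) / (2 * ρ))
    have h1 := Int.fract_lt_one ((t + ρ) / (2 * ρ))
    constructor <;> nlinarith
  · rw [← h, periodize]

theorem periodize_add (hρ : 0 < ρ) (he : e (-ρ) = e ρ) {θ : ℝ} (hθ : θ ∈ Icc (-ρ) ρ) (n : ℤ) :
    periodize e ρ (θ + 2 * ρ * n) = e θ := by
  obtain ⟨m, ⟨h1, h2⟩, h⟩ := exists_periodize_eq hρ e (θ + 2 * ρ * n)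
  rw [h]
  rcases lt_trichotomy m n with hmn | rfl | hmn
  · have : (m : ℝ) + 1 ≤ n := by exact_mod_cast hmn
    nlinarith [hθ.1]
  · rw [add_sub_cancel_right]
  · have h3 : (n : ℝ) + 1 ≤ m := by exact_mod_cast hmn
    have h4 : ρ ≤ θ := by nlinarith
    have h5 : θ = ρ := le_antisymm hθ.2 h4
    subst h5
    have h6 : (m : ℝ) = n + 1 := by
      by_contra hne
      have : n + 1 ≠ m := fun h => hne (by rw [← h]; push_cast; rfl)
      have : n + 2 ≤ m := by omega
      have : (n : ℝ) + 2 ≤ m := by exact_mod_cast this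
      nlinarith
    rw [h6, ← he]
    congr 1
    ring

theorem periodize_periodic (hρ : 0 < ρ) (he : e (-ρ) = e ρ) (t : ℝ) (n : ℤ) :
    periodize e ρ (t + 2 * ρ * n) = periodize e ρ t := by
  obtain ⟨m, hm, h⟩ := exists_periodize_eq hρ e t
  rw [h, ← periodize_add hρ he (Ico_subset_Icc_self hm) (m + n)]
  congr 1
  push_cast
  ring

variable [MetricSpace X]

theorem dist_periodize_le (hρ : 0 < ρ) (he : e (-ρ) = e ρ)
    (hL : ∀ s ∈ Icc (-ρ) ρ, ∀ t ∈ Icc (-ρ) ρ, s ≤ t → dist (e s) (e t) ≤ t - s)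
    {s t : ℝ} (hst : s ≤ t) : dist (periodize e ρ s) (periodize e ρ t) ≤ t - s := by
  obtain ⟨n, hn, hs⟩ := exists_periodize_eq hρ e s
  obtain ⟨m, hm, ht⟩ := exists_periodize_eq hρ e t
  rw [hs, ht]
  rcases lt_trichotomy m n with hmn | rfl | hmn
  · have : (m : ℝ) + 1 ≤ n := by exact_mod_cast hmn
    nlinarith [hn.1, hm.2]
  · have := hL _ (Ico_subset_Icc_self hn) _ (Ico_subset_Icc_self hm) (by linarith)
    linarith
  · have h1 : (n : ℝ) + 1 ≤ m := by exact_mod_cast hmn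
    have h2 := hL _ (Ico_subset_Icc_self hn) ρ ⟨by linarith, le_rfl⟩ hn.2.le
    have h3 := hL (-ρ) ⟨le_rfl, by linarith⟩ _ (Ico_subset_Icc_self hm) hm.1
    rw [he] at h3
    have h4 := dist_triangle (e (s - 2 * ρ * n)) (e ρ) (e (t - 2 * ρ * m))
    nlinarith

theorem lipschitzWith_periodize (hρ : 0 < ρ) (he : e (-ρ) = e ρ)
    (hL : ∀ s ∈ Icc (-ρ) ρ, ∀ t ∈ Icc (-ρ) ρ, s ≤ t → dist (e s) (e t) ≤ t - s) :
    LipschitzWith 1 (periodize e ρ) := by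
  refine LipschitzWith.of_dist_le_mul fun s t => ?_
  rw [NNReal.coe_one, one_mul, Real.dist_eq]
  rcases le_total s t with h | h
  · rw [abs_sub_comm, abs_of_nonneg (by linarith)]
    exact dist_periodize_le hρ he hL h
  · rw [dist_comm, abs_of_nonneg (by linarith)]
    exact dist_periodize_le hρ he hL h

/-- The patrol that follows a path on the real line with phase `φ`. -/
def phasePatrol (c : ℝ → X) (hc : LipschitzWith 1 c) (φ : ℝ) : Patrol X :=
  ⟨fun t => c (φ + t), by
    refine LipschitzWith.of_dist_le_mul fun s t => (hc.dist_le_mul _ _).trans_eq ?_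
    rw [dist_add_left]
    rfl⟩

theorem intercepts_phasePatrol {c : ℝ → X} (hc : LipschitzWith 1 c) {α φ s : ℝ} {τ : ℝ≥0}
    (h1 : s - τ - α ≤ φ) (h2 : φ ≤ s - τ) : Intercepts α (phasePatrol c hc φ) (c s, τ) := by
  have h0 : 0 ≤ s - φ := by linarith [NNReal.coe_nonneg τ]
  refine ⟨⟨s - φ, h0⟩, ?_, ?_, ?_⟩
  · refine NNReal.coe_le_coe.1 ?_
    change (τ : ℝ) ≤ s - φ
    linarith
  · change s - φ ≤ (τ : ℝ) + α
    linarith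
  · change c (φ + (s - φ)) = c s
    rw [add_sub_cancel]

/-- A patrol of period `2 * ρ` returns to each point of its tour within every time interval of that
length, so one fixed phase intercepts all attacks of this duration on the tour. -/
theorem intercepts_periodize (hρ : 0 < ρ) (he : e (-ρ) = e ρ)
    (hc : LipschitzWith 1 (periodize e ρ)) {θ : ℝ} (hθ : θ ∈ Icc (-ρ) ρ) (τ : ℝ≥0) :
    Intercepts (2 * ρ) (phasePatrol (periodize e ρ) hc 0) (e θ, τ) := by
  have hp : 0 < 2 * ρ := by linarith
  have h := toIcoMod_mem_Ico hp (τ : ℝ) θ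
  rw [← self_sub_toIcoDiv_zsmul, zsmul_eq_mul] at h
  rw [← periodize_add hρ he hθ (-toIcoDiv hp (τ : ℝ) θ)]
  refine intercepts_phasePatrol hc ?_ ?_ <;> push_cast <;> linarith [h.1, h.2]

variable [MeasurableSpace X] [BorelSpace X]

theorem measurable_phasePatrol {c : ℝ → X} (hc : LipschitzWith 1 c) :
    Measurable (phasePatrol c hc) := by
  refine Measurable.subtype_mk (measurable_pi_iff.2 fun t => ?_)
  exact (hc.continuous.comp (continuous_add_const _)).measurable

/-- The patrol with a uniformly random phase of a periodic path. -/
def randomPhase (c : ℝ → X) (hc : LipschitzWith 1 c) (ρ : ℝ) : Measure (Patrol X) :=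
  (ProbabilityTheory.cond (volume : Measure ℝ) (Ioc 0 (2 * ρ))).map (phasePatrol c hc)

theorem isProbabilityMeasure_randomPhase {c : ℝ → X} (hc : LipschitzWith 1 c) (hρ : 0 < ρ) :
    IsProbabilityMeasure (randomPhase c hc ρ) := by
  have : IsProbabilityMeasure (ProbabilityTheory.cond (volume : Measure ℝ) (Ioc 0 (2 * ρ))) := by
    refine cond_isProbabilityMeasure_of_finite ?_ ?_ <;> rw [Real.volume_Ioc]
    · simpa using hρ
    · exact ENNReal.ofReal_ne_top
  exact Measure.isProbabilityMeasure_map (measurable_phasePatrol hc).aemeasurable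

/-- The set of intercepting phases is invariant under shifts by the period, so it has the same
measure in every interval of length `2 * ρ`; the window can be placed where the phases `s` are
convenient. -/
theorem le_randomPhase_apply [SecondCountableTopology X] {α : ℝ} (hα : 0 ≤ α) (hρ : 0 < ρ)
    (he : e (-ρ) = e ρ)
    (hc : LipschitzWith 1 (periodize e ρ)) (a : Attack X) (b : ℝ) {s : Set ℝ}
    (hs : s ⊆ Ioc b (b + 2 * ρ))
    (hs' : ∀ φ ∈ s, Intercepts α (phasePatrol (periodize e ρ) hc φ) a) :
    ENNReal.ofReal (1 / (2 * ρ)) * volume s ≤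
      randomPhase (periodize e ρ) hc ρ {S | Intercepts α S a} := by
  have hp : 0 < 2 * ρ := by linarith
  have hmeas : MeasurableSet {S : Patrol X | Intercepts α S a} :=
    measurable_prodMk_right (measurableSet_intercepts hα)
  set G := phasePatrol (periodize e ρ) hc ⁻¹' {S | Intercepts α S a} with hG
  have hGm : MeasurableSet G := measurable_phasePatrol hc hmeas
  have hinv : ∀ g : AddSubgroup.zmultiples (2 * ρ), (fun x : ℝ => g +ᵥ x) ⁻¹' G = G := by
    rintro ⟨_, n, rfl⟩
    ext φ
    have : phasePatrol (periodize e ρ) hc (n • (2 * ρ) + φ) =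
        phasePatrol (periodize e ρ) hc φ := by
      apply Subtype.ext
      funext t
      change periodize e ρ (n • (2 * ρ) + φ + t) = periodize e ρ (φ + t)
      rw [← periodize_periodic hρ he (φ + t) n, zsmul_eq_mul]
      congr 1
      ring
    change phasePatrol (periodize e ρ) hc (n • (2 * ρ) + φ) ∈
      {S : Patrol X | Intercepts α S a} ↔ _
    rw [this]
    rfl
  have hshift : volume (G ∩ Ioc 0 (2 * ρ)) = volume (G ∩ Ioc b (b + 2 * ρ)) := by
    have := (isAddFundamentalDomain_Ioc hp 0 volume).measure_set_eq
      (isAddFundamentalDomain_Ioc hp b volume) hGm hinv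
    rwa [zero_add] at this
  rw [randomPhase, Measure.map_apply (measurable_phasePatrol hc) hmeas,
    cond_apply measurableSet_Ioc, Real.volume_Ioc, sub_zero, one_div,
    ENNReal.ofReal_inv_of_pos hp, inter_comm, hshift]
  have hsub : s ⊆ G ∩ Ioc b (b + 2 * ρ) := fun φ hφ => ⟨hs' φ hφ, hs hφ⟩
  exact mul_le_mul_right (measure_mono hsub) _

end Periodize

/-! ## Tours of the 6-1-1 star -/

theorem dist_le_sub_of_Icc_of_Icc {X : Type} [MetricSpace X] {e : ℝ → X} {a b c : ℝ}
    (h1 : ∀ s ∈ Icc a b, ∀ t ∈ Icc a b, s ≤ t → dist (e s) (e t) ≤ t - s)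
    (h2 : ∀ s ∈ Icc b c, ∀ t ∈ Icc b c, s ≤ t → dist (e s) (e t) ≤ t - s) :
    ∀ s ∈ Icc a c, ∀ t ∈ Icc a c, s ≤ t → dist (e s) (e t) ≤ t - s := by
  intro s hs t ht hst
  rcases le_total t b with htb | hbt
  · exact h1 s ⟨hs.1, hst.trans htb⟩ t ⟨ht.1, htb⟩ hst
  · rcases le_total s b with hsb | hbs
    · have h3 := h1 s ⟨hs.1, hsb⟩ b ⟨hs.1.trans hsb, le_rfl⟩ hsb
      have h4 := h2 b ⟨le_rfl, hbt.trans ht.2⟩ t ⟨hbt, ht.2⟩ hbt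
      linarith [dist_triangle (e s) (e b) (e t)]
    · exact h2 s ⟨hbs, hs.2⟩ t ⟨hbt, ht.2⟩ hst

theorem dist_arcPoint_comp_le {k : ℕ} {ℓ : Fin k → ℝ≥0} {i : Fin k} {f : ℝ → ℝ} {a b : ℝ}
    (hf : ∀ t ∈ Icc a b, f t ∈ Icc (0 : ℝ) (ℓ i)) (hL : ∀ s t, |f s - f t| ≤ |s - t|)
    {e : ℝ → Star ℓ} (he : ∀ t ∈ Icc a b, e t = arcPoint ℓ i (f t)) :
    ∀ s ∈ Icc a b, ∀ t ∈ Icc a b, s ≤ t → dist (e s) (e t) ≤ t - s := by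
  intro s hs t ht hst
  rw [he s hs, he t ht, dist_arcPoint_self (hf s hs) (hf t ht)]
  refine (hL s t).trans_eq ?_
  rw [abs_sub_comm, abs_of_nonneg (by linarith)]

/-- The shape `c - |t + d|` is shared by the excursions into the short arcs (`c = 1`, `d = ±1`) and
by the walk around node 9 (`c = 6`, `d = 0`). -/
theorem abs_sub_abs_comp_le (c d s t : ℝ) : |(c - |s + d|) - (c - |t + d|)| ≤ |s - t| := by
  have h := abs_abs_sub_abs_le (t + d) (s + d)
  rwa [add_sub_add_right_eq_sub, abs_sub_comm t s, ← sub_sub_sub_cancel_left _ _ c] at h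

/-- The closed tour of the 6-1-1 star, at time `θ ∈ [-8, 8]`: it starts at node 9, and it visits
nodes 1, 2, 9 at times `-1`, `1`, `8`. -/
def tour (θ : ℝ) : Star611 :=
  if θ ≤ -2 then arcPoint _ 0 (-θ - 2)
  else if θ ≤ 0 then arcPoint _ 1 (1 - |θ + 1|)
  else if θ ≤ 2 then arcPoint _ 2 (1 - |θ + -1|)
  else arcPoint _ 0 (θ - 2)

theorem tour_of_le {θ : ℝ} (h : θ ≤ -2) : tour θ = arcPoint _ 0 (-θ - 2) := if_pos h

theorem tour_of_mem_Icc_neg {θ : ℝ} (h : θ ∈ Icc (-2 : ℝ) 0) :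
    tour θ = arcPoint _ 1 (1 - |θ + 1|) := by
  rcases h.1.eq_or_lt with rfl | h2
  · rw [tour_of_le le_rfl]
    norm_num
    exact arcPoint_zero 0 1
  · rw [tour, if_neg h2.not_ge, if_pos h.2]

theorem tour_of_mem_Icc {θ : ℝ} (h : θ ∈ Icc (0 : ℝ) 2) :
    tour θ = arcPoint _ 2 (1 - |θ + -1|) := by
  rcases h.1.eq_or_lt with rfl | h0
  · rw [tour_of_mem_Icc_neg (by norm_num)]
    norm_num
    exact arcPoint_zero 1 2
  · rw [tour, if_neg (by linarith), if_neg h0.not_ge, if_pos h.2]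

theorem tour_of_ge {θ : ℝ} (h : 2 ≤ θ) : tour θ = arcPoint _ 0 (θ - 2) := by
  rcases h.eq_or_lt with rfl | h2
  · rw [tour_of_mem_Icc (by norm_num)]
    norm_num
    exact arcPoint_zero 2 0
  · rw [tour, if_neg (by linarith), if_neg (by linarith), if_neg h2.not_ge]

theorem tour_neg {ρ : ℝ} (h : 2 ≤ ρ) : tour (-ρ) = tour ρ := by
  rw [tour_of_le (by linarith), tour_of_ge h, neg_neg]

theorem dist_tour_le : ∀ s ∈ Icc (-8 : ℝ) 8, ∀ t ∈ Icc (-8 : ℝ) 8, s ≤ t →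
    dist (tour s) (tour t) ≤ t - s := by
  refine dist_le_sub_of_Icc_of_Icc (b := 0) (dist_le_sub_of_Icc_of_Icc (b := -2) ?_ ?_)
    (dist_le_sub_of_Icc_of_Icc (b := 2) ?_ ?_)
  · refine dist_arcPoint_comp_le (i := 0) (f := fun θ => -θ - 2) (fun t ht => ?_) (fun s t => ?_)
      fun t ht => tour_of_le ht.2
    · exact ⟨by linarith [ht.2], by change -t - 2 ≤ 6; linarith [ht.1]⟩
    · rw [sub_sub_sub_cancel_right, neg_sub_neg, abs_sub_comm]
  · refine dist_arcPoint_comp_le (i := 1) (f := fun θ => 1 - |θ + 1|) (fun t ht => ?_)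
      (abs_sub_abs_comp_le 1 1) fun t ht => tour_of_mem_Icc_neg ht
    have := abs_le.2 (show -1 ≤ t + 1 ∧ t + 1 ≤ 1 by constructor <;> linarith [ht.1, ht.2])
    exact ⟨by linarith, by change 1 - |t + 1| ≤ 1; linarith [abs_nonneg (t + 1)]⟩
  · refine dist_arcPoint_comp_le (i := 2) (f := fun θ => 1 - |θ + -1|) (fun t ht => ?_)
      (abs_sub_abs_comp_le 1 (-1)) fun t ht => tour_of_mem_Icc ht
    have := abs_le.2 (show -1 ≤ t + -1 ∧ t + -1 ≤ 1 by constructor <;> linarith [ht.1, ht.2])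
    exact ⟨by linarith, by change 1 - |t + -1| ≤ 1; linarith [abs_nonneg (t + -1)]⟩
  · refine dist_arcPoint_comp_le (i := 0) (f := fun θ => θ - 2) (fun t ht => ?_) (fun s t => ?_)
      fun t ht => tour_of_ge ht.1
    · exact ⟨by linarith [ht.1], by change t - 2 ≤ 6; linarith [ht.2]⟩
    · rw [sub_sub_sub_cancel_right]

/-- The short arcs use the times in `[-2, 2]`, which leaves `r - 2` on either side for the long arc.
With `r = 8` this covers the star; with `r = α / 2` it covers the part of `E` around the center. -/
theorem exists_tour_eq {x : Star611} {r : ℝ} (hr : 2 ≤ r) (hx : x.1 0 ≤ r - 2) :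
    ∃ θ ∈ Icc (-r) r, tour θ = x := by
  obtain ⟨i, t, ht, rfl⟩ := x.exists_eq_arcPoint
  fin_cases i
  · rw [show (arcPoint ![6, 1, 1] ((fun i => i) ⟨0, by norm_num⟩) t).1 0 = t from
      arcPoint_coord ht] at hx
    refine ⟨t + 2, ⟨by linarith [ht.1], by linarith⟩, ?_⟩
    rw [tour_of_ge (by linarith [ht.1]), add_sub_cancel_right]
    rfl
  · have h1 : t ≤ 1 := ht.2
    have h0 : 0 ≤ t := ht.1
    refine ⟨t - 2, ⟨by linarith, by linarith⟩, ?_⟩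
    rw [tour_of_mem_Icc_neg ⟨by linarith, by linarith⟩, abs_of_nonpos (by linarith)]
    ring_nf
    rfl
  · have h1 : t ≤ 1 := ht.2
    have h0 : 0 ≤ t := ht.1
    refine ⟨t, ⟨by linarith, by linarith⟩, ?_⟩
    rw [tour_of_mem_Icc ⟨by linarith, by linarith⟩, abs_of_nonpos (by linarith)]
    ring_nf
    rfl

theorem tour_eq_of_pos {x : Star611} (hx : 0 < x.1 0) : tour (x.1 0 + 2) = x := by
  rw [tour_of_ge (by linarith), add_sub_cancel_right, ← Star.eq_arcPoint_of_pos hx]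

/-- The walk along the long arc that visits node 9 at time `0`. -/
def longArcWalk (θ : ℝ) : Star611 := arcPoint _ 0 (6 - |θ + 0|)

theorem longArcWalk_neg (ρ : ℝ) : longArcWalk (-ρ) = longArcWalk ρ := by
  rw [longArcWalk, longArcWalk, add_zero, add_zero, abs_neg]

theorem dist_longArcWalk_le {ρ : ℝ} (hρ : ρ ≤ 6) : ∀ s ∈ Icc (-ρ) ρ, ∀ t ∈ Icc (-ρ) ρ, s ≤ t →
    dist (longArcWalk s) (longArcWalk t) ≤ t - s := by
  refine dist_arcPoint_comp_le (i := 0) (f := fun θ => 6 - |θ + 0|) (fun t ht => ?_)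
    (abs_sub_abs_comp_le 6 0) fun t ht => rfl
  have := abs_le.2 ht
  rw [add_zero]
  exact ⟨by linarith, by change 6 - |t| ≤ 6; linarith [abs_nonneg t]⟩

theorem exists_longArcWalk_eq {x : Star611} {r : ℝ} (hr : r < 6) (hx : 6 - r ≤ x.1 0) :
    ∃ θ ∈ Icc (-r) r, longArcWalk θ = x := by
  have h6 : x.1 0 ≤ 6 := (x.coord_mem 0).2
  refine ⟨6 - x.1 0, ⟨by linarith, by linarith⟩, ?_⟩
  rw [longArcWalk, add_zero, abs_of_nonneg (by linarith), sub_sub_cancel,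
    ← Star.eq_arcPoint_of_pos (by linarith)]

/-! ## The optimal mixed patrol -/

theorem lipschitzWith_periodize_tour {ρ : ℝ} (h2 : 2 ≤ ρ) (h8 : ρ ≤ 8) :
    LipschitzWith 1 (periodize tour ρ) := by
  refine lipschitzWith_periodize (by linarith) (tour_neg h2) fun s hs t ht => ?_
  exact dist_tour_le s ⟨by linarith [hs.1], hs.2.trans h8⟩ t ⟨by linarith [ht.1], ht.2.trans h8⟩

theorem lipschitzWith_periodize_longArcWalk {ρ : ℝ} (h0 : 0 < ρ) (h6 : ρ ≤ 6) :
    LipschitzWith 1 (periodize longArcWalk ρ) :=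
  lipschitzWith_periodize h0 (longArcWalk_neg ρ) (dist_longArcWalk_le h6)

/-- The full tour with a uniformly random phase. -/
def randomTour : Measure (Patrol Star611) :=
  randomPhase (periodize tour 8) (lipschitzWith_periodize_tour (by norm_num) le_rfl) 8

theorem le_randomTour_apply {α : ℝ} (hα : 0 ≤ α) (hα' : α ≤ 8) (a : Attack Star611) :
    ENNReal.ofReal (α / 16) ≤ randomTour {S | Intercepts α S a} := by
  obtain ⟨θ, hθ, h⟩ := exists_tour_eq (x := a.1) (r := 8) (by norm_num)
    (by have := (a.1.coord_mem 0).2; change a.1.1 0 ≤ 6 at this; linarith)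
  refine le_trans ?_ (le_randomPhase_apply hα (by norm_num) (tour_neg (by norm_num))
    (lipschitzWith_periodize_tour (by norm_num) le_rfl) a (θ - a.2 - α)
    (s := Ioc (θ - a.2 - α) (θ - a.2))
    (Ioc_subset_Ioc_right (by linarith)) fun φ hφ => ?_)
  · rw [Real.volume_Ioc, ← ENNReal.ofReal_mul (by norm_num)]
    apply ENNReal.ofReal_le_ofReal
    linarith
  · have := intercepts_phasePatrol (τ := a.2)
      (lipschitzWith_periodize_tour (ρ := 8) (by norm_num) le_rfl) hφ.1.le hφ.2
    have h' := periodize_add (ρ := 8) (by norm_num) (tour_neg (by norm_num)) hθ 0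
    rw [Int.cast_zero, mul_zero, add_zero, h] at h'
    rwa [h'] at this

/-- The tour passes the point at times `±(t + 2)`. The gaps `2 * (t + 2)` and `12 - 2 * t` both
exceed `α`, so the two sets of intercepting phases are disjoint and fit into one period. -/
theorem le_randomTour_apply_of_middle {α : ℝ} (hα : 0 ≤ α) (a : Attack Star611)
    (h1 : α / 2 - 2 < a.1.1 0) (h2 : a.1.1 0 < 6 - α / 2) (h0 : 0 < a.1.1 0) :
    ENNReal.ofReal (α / 8) ≤ randomTour {S | Intercepts α S a} := by
  set t := a.1.1 0 with ht
  have htour : tour (t + 2) = a.1 := tour_eq_of_pos h0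
  have hρ : t + 2 ∈ Icc (-8 : ℝ) 8 := ⟨by linarith, by linarith⟩
  have hρ' : -(t + 2) ∈ Icc (-8 : ℝ) 8 := ⟨by linarith, by linarith⟩
  have hp := fun θ (hθ : θ ∈ Icc (-8 : ℝ) 8) =>
    periodize_add (ρ := 8) (by norm_num) (tour_neg (by norm_num)) hθ 0
  simp only [Int.cast_zero, mul_zero, add_zero] at hp
  refine le_trans ?_ (le_randomPhase_apply hα (by norm_num) (tour_neg (by norm_num))
    (lipschitzWith_periodize_tour (by norm_num) le_rfl) a (-(t + 2) - a.2 - α)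
    (s := Ioc (-(t + 2) - a.2 - α) (-(t + 2) - a.2) ∪ Ioc (t + 2 - a.2 - α) (t + 2 - a.2))
    (union_subset (Ioc_subset_Ioc_right (by linarith)) (Ioc_subset_Ioc (by linarith) (by linarith)))
    fun φ hφ => ?_)
  · rw [measure_union _ measurableSet_Ioc, Real.volume_Ioc, Real.volume_Ioc,
      ← ENNReal.ofReal_add (by linarith) (by linarith), ← ENNReal.ofReal_mul (by norm_num)]
    · apply ENNReal.ofReal_le_ofReal
      linarith
    · exact Set.disjoint_left.2 fun φ hφ hφ' => by linarith [hφ.2, hφ'.1]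
  · rcases hφ with hφ | hφ
    · have := intercepts_phasePatrol (τ := a.2)
        (lipschitzWith_periodize_tour (ρ := 8) (by norm_num) le_rfl) hφ.1.le hφ.2
      rwa [hp _ hρ', tour_neg (by linarith), htour] at this
    · have := intercepts_phasePatrol (τ := a.2)
        (lipschitzWith_periodize_tour (ρ := 8) (by norm_num) le_rfl) hφ.1.le hφ.2
      rwa [hp _ hρ, htour] at this

/-- The weights equalize the guarantees: on `E` a short walk intercepts surely and is added to `α /
16` from the full tour, while in the middle the doubled rate `α / 8` of the full tour alone gives
the same total. -/
theorem exists_optimal_patrol {α : ℝ} (hα : 4 ≤ α) (hα' : α ≤ 8) :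
    ∃ P : Measure (Patrol Star611), IsProbabilityMeasure P ∧
      ∀ a, ENNReal.ofReal (α / (8 + α)) ≤ P {S | Intercepts α S a} := by
  have hl := lipschitzWith_periodize_tour (ρ := α / 2) (by linarith) (by linarith)
  have hr := lipschitzWith_periodize_longArcWalk (ρ := α / 2) (by linarith) (by linarith)
  have hm : ∀ a, MeasurableSet {S : Patrol Star611 | Intercepts α S a} := fun a =>
    measurable_prodMk_right (measurableSet_intercepts (by linarith))
  have : IsProbabilityMeasure randomTour := isProbabilityMeasure_randomPhase _ (by norm_num)
  refine ⟨ENNReal.ofReal (8 / (8 + α)) • randomTour +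
    (ENNReal.ofReal (α / (2 * (8 + α))) • Measure.dirac (phasePatrol _ hl 0) +
      ENNReal.ofReal (α / (2 * (8 + α))) • Measure.dirac (phasePatrol _ hr 0)), ⟨?_⟩, fun a => ?_⟩
  · simp only [Measure.add_apply, Measure.smul_apply, smul_eq_mul, measure_univ, mul_one]
    rw [← ENNReal.ofReal_add (by positivity) (by positivity),
      ← ENNReal.ofReal_add (by positivity) (by positivity), ENNReal.ofReal_eq_one]
    field_simp
    ring
  · have hsum : ENNReal.ofReal (α / (8 + α)) =
        ENNReal.ofReal (8 / (8 + α)) * ENNReal.ofReal (α / 16) +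
          ENNReal.ofReal (α / (2 * (8 + α))) := by
      rw [← ENNReal.ofReal_mul (by positivity), ← ENNReal.ofReal_add (by positivity) (by positivity)]
      congr 1
      field_simp
      norm_num
    have hsum' : ENNReal.ofReal (α / (8 + α)) =
        ENNReal.ofReal (8 / (8 + α)) * ENNReal.ofReal (α / 8) := by
      rw [← ENNReal.ofReal_mul (by positivity)]
      congr 1
      field_simp
    simp only [Measure.add_apply, Measure.smul_apply, smul_eq_mul, Measure.dirac_apply' _ (hm a)]
    rcases le_or_gt (a.1.1 0) (α / 2 - 2) with h1 | h1
    · obtain ⟨θ, hθ, h⟩ := exists_tour_eq (by linarith) h1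
      have hI := intercepts_periodize (by linarith) (tour_neg (by linarith)) hl hθ a.2
      rw [h, mul_div_cancel₀ α two_ne_zero] at hI
      rw [hsum, indicator_of_mem (show phasePatrol _ hl 0 ∈ {S | Intercepts α S a} from hI)]
      gcongr
      · exact le_randomTour_apply (by linarith) hα' a
      · simp
    rcases le_or_gt (6 - α / 2) (a.1.1 0) with h2 | h2
    · obtain ⟨θ, hθ, h⟩ := exists_longArcWalk_eq (by linarith) h2
      have hI := intercepts_periodize (by linarith) (longArcWalk_neg _) hr hθ a.2
      rw [h, mul_div_cancel₀ α two_ne_zero] at hI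
      rw [hsum, indicator_of_mem (show phasePatrol _ hr 0 ∈ {S | Intercepts α S a} from hI)]
      gcongr
      · exact le_randomTour_apply (by linarith) hα' a
      · simp
    · rw [hsum']
      refine le_add_right ?_
      gcongr
      exact le_randomTour_apply_of_middle (by linarith) a h1 h2 (by linarith)

theorem hasValue_star611 {α : ℝ} (hα : 4 ≤ α) (hα' : α ≤ 8) :
    HasValue Star611 α (vStar Star611 α) := by
  obtain ⟨P, hP, h⟩ := exists_optimal_patrol hα hα'
  have := isProbabilityMeasure_attack611 hα hα'
  refine hasValue_of_saddle (by linarith) P (fun a => ?_) (attack611 α)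
    (attack611_intercepts_le hα hα')
  rw [vStar_star611 hα hα']
  exact h a

theorem not_hasValue_star611 {α : ℝ} (hα : 4 ≤ α) (hα' : α < 8) :
    ¬ HasValue Star611 α (ENNReal.ofReal α / (2 * totalLength Star611)) := by
  intro h
  have h2 := (hasValue_star611 hα hα'.le).1.symm.trans h.1
  rw [vStar_star611 hα hα'.le, totalLength_star611,
    show (2 * 8 : ℝ≥0∞) = ENNReal.ofReal 16 by norm_num,
    ← ENNReal.ofReal_div_of_pos (by norm_num),
    ENNReal.ofReal_eq_ofReal_iff (by positivity) (by positivity)] at h2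
  rw [div_eq_div_iff (by linarith) (by norm_num)] at h2
  -- Equality of the two candidate values would force `α = 8`.
  nlinarith

end Patrolling

end

theorem mainTheorem5 :
    -- the 6-1-1 star is a tree network of total length 8 and diameter 7
    Patrolling.IsTreeNetwork Patrolling.Star611 ∧
    Patrolling.totalLength Patrolling.Star611 = 8 ∧
    Metric.diam (Set.univ : Set Patrolling.Star611) = 7 ∧
    (∀ α : ℝ, 4 ≤ α → α ≤ 8 →
      -- the extremity set has length α, and the value is v*
      Patrolling.length Patrolling.Star611 (Patrolling.extremitySet Patrolling.Star611 α)
        = ENNReal.ofReal α ∧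
      Patrolling.HasValue Patrolling.Star611 α (Patrolling.vStar Patrolling.Star611 α) ∧
      -- the 6-1-1-attack is a mixed strategy; no pure patrol intercepts it with probability
      -- more than v*, some patrol does so with probability v*, and v* is also the supremum over
      -- all mixed patrols
      IsProbabilityMeasure (Patrolling.attack611 α) ∧
      IsGreatest
        (Set.range fun S : Patrolling.Patrol Patrolling.Star611 =>
          Patrolling.attack611 α {a | Patrolling.Intercepts α S a})
        (Patrolling.vStar Patrolling.Star611 α) ∧
      (⨆ P : ProbabilityMeasure (Patrolling.Patrol Patrolling.Star611),
        Patrolling.interceptProb α (P : Measure (Patrolling.Patrol Patrolling.Star611))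
          (Patrolling.attack611 α)) = Patrolling.vStar Patrolling.Star611 α) ∧
    -- for 7 ≤ α < 8 the value is not α / (2 μ), so the diameter conjecture fails
    (∀ α : ℝ, 7 ≤ α → α < 8 →
      ¬ Patrolling.HasValue Patrolling.Star611 α
        (ENNReal.ofReal α / (2 * Patrolling.totalLength Patrolling.Star611))) ∧
    ¬ Patrolling.DiameterConjecture := by
  refine ⟨Patrolling.Star.isTreeNetwork _, Patrolling.totalLength_star611,
    Patrolling.diam_star611, fun α hα hα' => ?_, fun α hα hα' =>
    Patrolling.not_hasValue_star611 (by linarith) hα', fun h => ?_⟩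
  · obtain ⟨P, hP, hPa⟩ := Patrolling.exists_optimal_patrol hα hα'
    have := Patrolling.isProbabilityMeasure_attack611 hα hα'
    have hA := Patrolling.attack611_intercepts_le hα hα'
    rw [← Patrolling.vStar_star611 hα hα'] at hPa
    exact ⟨Patrolling.length_extremitySet hα hα', Patrolling.hasValue_star611 hα hα', this,
      Patrolling.isGreatest_of_saddle (by linarith) P hPa _ hA,
      Patrolling.iSup_interceptProb_of_saddle (by linarith) P hPa _ hA⟩
  · refine Patrolling.not_hasValue_star611 (α := 7) (by norm_num) (by norm_num)
      (h _ (Patrolling.Star.isTreeNetwork _) 7 (by norm_num) Patrolling.diam_star611.le ?_)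
    rw [Patrolling.totalLength_star611, ENNReal.ofReal_ofNat]
    norm_num
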